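/- **Notation and definitions.** Let $\theta\ge 1/2$. *Gelfand–Shilov space.* $\mathcal S_\theta(\mathbb R^d)$ is the space of all $f\in C^\infty(\mathbb R^d)$ such that for some $C>0$ $$p_C(f):=\sup_{\alpha,\beta\in\mathbb N^d}\sup_{x\in\mathbb R^d}C^{-|\alpha|-|\beta|}(\alpha!)^{-\theta}(\beta!)^{-\theta}|x^\alpha\partial^\beta f(x)|<\infty ,$$ and $\mathcal S_\theta'(\mathbb R^d)$ is the space of linear forms $u$ on $\mathcal S_\theta(\mathbb R^d)$ such that for every $\varepsilon>0$ there is $K_\varepsilon>0$ with $|\langle u,f\rangle|\le K_\varepsilon\, p_\varepsilon(f)$ for all $f\in\mathcal S_\theta(\mathbb R^d)$. The pairing $\langle u,f\rangle$ is bilinear. *Wave front set.* For $u\in\mathcal S_\theta'(\mathbb R^d)$ and $z\in\mathbb C^d$ let $Tu(z)=2^{-d/2}\pi^{-3d/4}\langle u_y,e^{i\langle z,y\rangle-\frac12|y|^2}\rangle$, where $\langle z,y\rangle=\sum_j z_jy_j$, be the FBI transform with the standard phase $\langle z,y\rangle+\frac i2|y|^2$. The global wave front set $\mathrm{WF}^\theta_{\mathrm{gl}}(u)\subset\mathbb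 R^{2d}\setminus\{0\}$ is the set of all $(x_0,\xi_0)\ne 0$ for which there do **not** exist an open conic neighbourhood $\Gamma\subset\mathbb C^d$ of $-\xi_0-ix_0$ and constants $\varepsilon,C>0$ such that $$|Tu(z)|\le C\,e^{-\varepsilon|z|^{1/\theta}+\frac12|\operatorname{Im}z|^2},\qquad z\in\Gamma .$$ *Localization operators.* Let $\psi(y)=\pi^{-d/4}e^{-|y|^2/2}$ and let $V_\psi u(x,\xi)=(2\pi)^{-d/2}\langle u,\psi(\cdot-x)e^{-i\langle\xi,\cdot\rangle}\rangle$ be the short-time Fourier transform of $u\in\mathcal S_\theta'(\mathbb R^d)$ (for $u=g\in\mathcal S_\theta(\mathbb R^d)$ the pairing is $\int g(y)\,\psi(y-x)e^{-i\langle\xi,y\rangle}\,dy$). The localization operator $A^\psi_a=V_\psi^*\,a\,V_\psi$ with symbol $a$ is defined weakly by $$\langle A^\psi_a u,f\rangle=\int_{\mathbb R^{2d}}a(x,\xi)\,V_\psi u(x,\xi)\,\overline{V_\psi\bar f(x,\xi)}\;dx\,d\xi,\qquad u\in\mathcal S_\theta'(\mathbb R^d),\ f\in\mathcal S_\theta(\mathbb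 R^d).$$ **Proposition (Microlocality of localization operators).** Let $\theta>1/2$ and let $a\in L^\infty_{\mathrm{loc}}(\mathbb R^{2d})$ be such that for every $\varepsilon>0$ there is $C_\varepsilon>0$ with $$|a(x,\xi)|\le C_\varepsilon\, e^{\varepsilon(|x|^{1/\theta}+|\xi|^{1/\theta})}\qquad\text{for almost all }(x,\xi)\in\mathbb R^{2d}.$$ Then the integral defining $\langle A^\psi_au,f\rangle$ converges absolutely for all $u\in\mathcal S_\theta'(\mathbb R^d)$ and $f\in\mathcal S_\theta(\mathbb R^d)$ and defines a linear operator $A^\psi_a:\mathcal S_\theta'(\mathbb R^d)\to\mathcal S_\theta'(\mathbb R^d)$, and $$\mathrm{WF}^\theta_{\mathrm{gl}}(A^\psi_au)\subset\mathrm{WF}^\theta_{\mathrm{gl}}(u)\qquad\text{for every }u\in\mathcal S_\theta'(\mathbb R^d).$$ -/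

import Mathlib

open scoped ContDiff Nat ComplexConjugate
open MeasureTheory

namespace GelfandShilov

/-- `ℝ^d` with the Euclidean norm. -/
abbrev Rd (d : ℕ) : Type := EuclideanSpace ℝ (Fin d)

/-- `ℂ^d` with the Hermitian norm. -/
abbrev Cd (d : ℕ) : Type := EuclideanSpace ℂ (Fin d)

/-! ### Gelfand-Shilov functions and tempered ultradistributions -/

/-- The partial derivative `∂_i f`. -/
noncomputable def partialDeriv {d : ℕ} (i : Fin d) (f : Rd d → ℂ) : Rd d → ℂ :=
  fun x => fderiv ℝ f x (EuclideanSpace.single i 1)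

/-- The derivative `∂^β f` for a multi-index `β`. -/
noncomputable def multiDeriv {d : ℕ} (β : Fin d → ℕ) (f : Rd d → ℂ) : Rd d → ℂ :=
  (List.finRange d).foldr (fun i g => (partialDeriv i)^[β i] g) f

/-- `sup_{α,β,x} C^{-|α|-|β|} (α!)^{-θ} (β!)^{-θ} |x^α ∂^β f(x)| ≤ M`. -/
def GSBound {d : ℕ} (θ C M : ℝ) (f : Rd d → ℂ) : Prop :=
  ∀ (α β : Fin d → ℕ) (x : Rd d),
    ‖((∏ i, x i ^ α i : ℝ) : ℂ) * multiDeriv β f x‖ ≤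
      M * C ^ (∑ i, α i + ∑ i, β i) *
        ((∏ i, (α i)! : ℕ) : ℝ) ^ θ * ((∏ i, (β i)! : ℕ) : ℝ) ^ θ

theorem contDiff_partialDeriv {d : ℕ} (i : Fin d) {f : Rd d → ℂ} (hf : ContDiff ℝ ∞ f) :
    ContDiff ℝ ∞ (partialDeriv i f) :=
  (hf.fderiv_right (m := ∞) (by simp)).clm_apply contDiff_const

theorem contDiff_iterate_partialDeriv {d : ℕ} (i : Fin d) (n : ℕ) {f : Rd d → ℂ}
    (hf : ContDiff ℝ ∞ f) : ContDiff ℝ ∞ ((partialDeriv i)^[n] f) := by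
  induction n with
  | zero => exact hf
  | succ n ih =>
    rw [Function.iterate_succ_apply']
    exact contDiff_partialDeriv i ih

theorem partialDeriv_add {d : ℕ} (i : Fin d) {f g : Rd d → ℂ} (hf : ContDiff ℝ ∞ f)
    (hg : ContDiff ℝ ∞ g) : partialDeriv i (f + g) = partialDeriv i f + partialDeriv i g := by
  funext x
  have h1 := (hf.differentiable (by simp)) x
  have h2 := (hg.differentiable (by simp)) x
  simp [partialDeriv, fderiv_add h1 h2]

theorem partialDeriv_smul {d : ℕ} (i : Fin d) (c : ℂ) {f : Rd d → ℂ} (hf : ContDiff ℝ ∞ f) :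
    partialDeriv i (c • f) = c • partialDeriv i f := by
  funext x
  have h1 := (hf.differentiable (by simp)) x
  simp [partialDeriv, fderiv_const_smul h1 c]

theorem multiDeriv_linear {d : ℕ} (β : Fin d → ℕ) {f g : Rd d → ℂ} (hf : ContDiff ℝ ∞ f)
    (hg : ContDiff ℝ ∞ g) (c : ℂ) :
    multiDeriv β (f + g) = multiDeriv β f + multiDeriv β g ∧
      multiDeriv β (c • f) = c • multiDeriv β f := by
  have hit : ∀ (i : Fin d) (n : ℕ) (f g : Rd d → ℂ), ContDiff ℝ ∞ f → ContDiff ℝ ∞ g →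
      (partialDeriv i)^[n] (f + g) = (partialDeriv i)^[n] f + (partialDeriv i)^[n] g ∧
      (partialDeriv i)^[n] (c • f) = c • (partialDeriv i)^[n] f := by
    intro i n f g hf hg
    induction n with
    | zero => simp
    | succ n ih =>
      simp only [Function.iterate_succ_apply']
      rw [ih.1, ih.2, partialDeriv_add i (contDiff_iterate_partialDeriv i n hf)
        (contDiff_iterate_partialDeriv i n hg),
        partialDeriv_smul i c (contDiff_iterate_partialDeriv i n hf)]
      exact ⟨rfl, rfl⟩
  have main : ∀ l : List (Fin d),
      ContDiff ℝ ∞ (l.foldr (fun i g => (partialDeriv i)^[β i] g) f) ∧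
      ContDiff ℝ ∞ (l.foldr (fun i g => (partialDeriv i)^[β i] g) g) ∧
      l.foldr (fun i g => (partialDeriv i)^[β i] g) (f + g) =
        l.foldr (fun i g => (partialDeriv i)^[β i] g) f +
        l.foldr (fun i g => (partialDeriv i)^[β i] g) g ∧
      l.foldr (fun i g => (partialDeriv i)^[β i] g) (c • f) =
        c • l.foldr (fun i g => (partialDeriv i)^[β i] g) f := by
    intro l
    induction l with
    | nil => exact ⟨hf, hg, rfl, rfl⟩
    | cons i l ih =>
      obtain ⟨h1, h2, h3, h4⟩ := ih
      simp only [List.foldr_cons]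
      rw [h3, h4]
      exact ⟨contDiff_iterate_partialDeriv i _ h1, contDiff_iterate_partialDeriv i _ h2,
        (hit i _ _ _ h1 h2).1, (hit i _ _ _ h1 h2).2⟩
  exact (main _).2.2

theorem GSBound.nonneg {d : ℕ} {θ C M : ℝ} {f : Rd d → ℂ} (h : GSBound θ C M f) : 0 ≤ M := by
  have := (norm_nonneg _).trans (h 0 0 0)
  simpa using this

theorem GSBound.mono {d : ℕ} {θ C C' M : ℝ} {f : Rd d → ℂ} (h : GSBound θ C M f)
    (hC : 0 < C) (hCC : C ≤ C') : GSBound θ C' M f := by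
  intro α β x
  have hM := h.nonneg
  refine (h α β x).trans ?_
  gcongr

/-- The Gelfand-Shilov space `S_θ(ℝ^d)`. -/
noncomputable def GS (θ : ℝ) (d : ℕ) : Submodule ℂ (Rd d → ℂ) where
  carrier := {f | ContDiff ℝ ∞ f ∧ ∃ C > 0, ∃ M, GSBound θ C M f}
  zero_mem' := by
    refine ⟨contDiff_const, 1, one_pos, 0, fun α β x => ?_⟩
    have h0 := (multiDeriv_linear β (f := 0) (g := 0) contDiff_const contDiff_const 0).2
    rw [zero_smul, zero_smul] at h0
    simp [h0]
  add_mem' := by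
    rintro f g ⟨hf, C, hC, M, hM⟩ ⟨hg, C', hC', M', hM'⟩
    refine ⟨hf.add hg, max C C', lt_max_of_lt_left hC, M + M', fun α β x => ?_⟩
    rw [(multiDeriv_linear β hf hg 0).1, Pi.add_apply, mul_add, add_mul, add_mul, add_mul]
    exact (norm_add_le _ _).trans (add_le_add
      (hM.mono hC (le_max_left _ _) α β x) (hM'.mono hC' (le_max_right _ _) α β x))
  smul_mem' := by
    rintro c f ⟨hf, C, hC, M, hM⟩
    refine ⟨contDiff_const.smul hf, C, hC, ‖c‖ * M, fun α β x => ?_⟩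
    rw [(multiDeriv_linear β hf hf c).2, Pi.smul_apply, smul_eq_mul, mul_left_comm, norm_mul,
      mul_assoc, mul_assoc, mul_assoc, ← mul_assoc M, ← mul_assoc (M * _)]
    exact mul_le_mul_of_nonneg_left (hM α β x) (norm_nonneg _)

/-- The space `S_θ'(ℝ^d)` of tempered ultradistributions: the linear forms `u` on `S_θ(ℝ^d)` such
that for every `ε > 0` there is `K` with
`|u(f)| ≤ K sup_{α,β,x} ε^{-|α|-|β|} (α!)^{-θ} (β!)^{-θ} |x^α ∂^β f(x)|` for all `f`
(no condition on those `f` for which the supremum is infinite). -/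
noncomputable def GSDual (θ : ℝ) (d : ℕ) : Submodule ℂ (GS θ d →ₗ[ℂ] ℂ) where
  carrier := {u | ∀ ε > 0, ∃ K : ℝ, ∀ (f : GS θ d) (M : ℝ),
    GSBound θ ε M (f : Rd d → ℂ) → ‖u f‖ ≤ K * M}
  zero_mem' := fun ε _ => ⟨0, fun f M _ => by simp⟩
  add_mem' := by
    intro u v hu hv ε hε
    obtain ⟨K, hK⟩ := hu ε hε
    obtain ⟨L, hL⟩ := hv ε hε
    refine ⟨K + L, fun f M hf => ?_⟩
    rw [LinearMap.add_apply, add_mul]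
    exact (norm_add_le _ _).trans (add_le_add (hK f M hf) (hL f M hf))
  smul_mem' := by
    intro c u hu ε hε
    obtain ⟨K, hK⟩ := hu ε hε
    refine ⟨‖c‖ * K, fun f M hf => ?_⟩
    rw [LinearMap.smul_apply, smul_eq_mul, norm_mul, mul_assoc]
    exact mul_le_mul_of_nonneg_left (hK f M hf) (norm_nonneg _)

/-! ### The Gaussian kernel of the FBI transform belongs to `S_θ` for `θ ≥ 1/2` -/

/-- `y ↦ e^{iφ(z,y)}` for the standard phase `φ(z,y) = ⟨z,y⟩ + (i/2)|y|²`, where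
`⟨z,y⟩ = ∑ z_j y_j`. -/
noncomputable def fbiKernel {d : ℕ} (z : Cd d) (y : Rd d) : ℂ :=
  Complex.exp (Complex.I * (∑ j, z j * (y j : ℂ) + Complex.I / 2 * ((‖y‖ ^ 2 : ℝ) : ℂ)))

/-- The one-dimensional kernel, as an entire function. -/
noncomputable def kernelOne (z w : ℂ) : ℂ := Complex.exp (Complex.I * z * w - w ^ 2 / 2)

theorem contDiff_kernelOne (z : ℂ) : ContDiff ℂ ω (kernelOne z) := by
  unfold kernelOne
  fun_prop

theorem differentiable_iteratedDeriv_kernelOne (z : ℂ) (n : ℕ) :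
    Differentiable ℂ (iteratedDeriv n (kernelOne z)) :=
  ((contDiff_kernelOne z).of_le (le_top : (∞ : WithTop ℕ∞) ≤ ω)).differentiable_iteratedDeriv n
    (by exact_mod_cast WithTop.coe_lt_top n)

theorem fbiKernel_eq_prod {d : ℕ} (z : Cd d) (y : Rd d) :
    fbiKernel z y = ∏ j, kernelOne (z j) (y j : ℂ) := by
  unfold fbiKernel kernelOne
  rw [← Complex.exp_sum, EuclideanSpace.real_norm_sq_eq]
  congr 1
  push_cast
  rw [mul_add, Finset.mul_sum, ← mul_assoc, Finset.mul_sum, ← Finset.sum_add_distrib]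
  refine Finset.sum_congr rfl fun j _ => ?_
  have : Complex.I * (Complex.I / 2) = -1 / 2 := by
    rw [← mul_div_assoc, Complex.I_mul_I]
  rw [this]
  ring

theorem contDiff_kernel_prod {d : ℕ} (z : Cd d) (n : Fin d → ℕ) :
    ContDiff ℝ ∞ (fun y : Rd d => ∏ j, iteratedDeriv (n j) (kernelOne (z j)) (y j : ℂ)) := by
  refine contDiff_prod fun j _ => ?_
  have h1 : ContDiff ℝ ∞ (iteratedDeriv (n j) (kernelOne (z j))) :=
    ((differentiable_iteratedDeriv_kernelOne (z j) (n j)).contDiff (n := ∞)).restrict_scalars ℝ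
  have h2 : ContDiff ℝ ∞ (fun y : Rd d => ((y j : ℝ) : ℂ)) :=
    Complex.ofRealCLM.contDiff.comp (EuclideanSpace.proj (𝕜 := ℝ) j).contDiff
  exact h1.comp h2

theorem partialDeriv_prod {d : ℕ} (z : Cd d) (n : Fin d → ℕ) (i : Fin d) :
    partialDeriv i (fun y : Rd d => ∏ j, iteratedDeriv (n j) (kernelOne (z j)) (y j : ℂ)) =
      fun y : Rd d => ∏ j, iteratedDeriv (Function.update n i (n i + 1) j)
        (kernelOne (z j)) (y j : ℂ) := by
  funext y
  have hF := ((contDiff_kernel_prod z n).differentiable (by simp)) y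
  have h1 := hF.hasFDerivAt.hasLineDerivAt (EuclideanSpace.single i 1)
  have hG : HasDerivAt (iteratedDeriv (n i) (kernelOne (z i)))
      (iteratedDeriv (n i + 1) (kernelOne (z i)) (y i : ℂ)) ((y i + (0 : ℝ) : ℝ) : ℂ) := by
    rw [iteratedDeriv_succ, add_zero]
    exact (differentiable_iteratedDeriv_kernelOne (z i) (n i) _).hasDerivAt
  have hG2 : HasDerivAt (fun t : ℝ => iteratedDeriv (n i) (kernelOne (z i)) ((y i + t : ℝ) : ℂ))
      (iteratedDeriv (n i + 1) (kernelOne (z i)) (y i : ℂ)) 0 := by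
    have := (hG.comp_ofReal (z := y i + 0)).comp_const_add (y i) 0
    exact this
  have h2 : HasLineDerivAt ℝ
      (fun y : Rd d => ∏ j, iteratedDeriv (n j) (kernelOne (z j)) (y j : ℂ))
      (iteratedDeriv (n i + 1) (kernelOne (z i)) (y i : ℂ) *
        ∏ j ∈ Finset.univ.erase i, iteratedDeriv (n j) (kernelOne (z j)) (y j : ℂ)) y
      (EuclideanSpace.single i 1) := by
    refine (hG2.mul_const _).congr_of_eventuallyEq (Filter.Eventually.of_forall fun t => ?_)
    simp only []
    rw [← Finset.mul_prod_erase _ _ (Finset.mem_univ i)]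
    congr 1
    · simp
    · refine Finset.prod_congr rfl fun j hj => ?_
      simp [Finset.ne_of_mem_erase hj]
  have h3 := h1.unique h2
  unfold partialDeriv
  rw [h3, ← Finset.mul_prod_erase _ _ (Finset.mem_univ i)]
  congr 1
  · simp
  · refine Finset.prod_congr rfl fun j hj => ?_
    simp [Finset.ne_of_mem_erase hj]

theorem multiDeriv_fbiKernel {d : ℕ} (z : Cd d) (β : Fin d → ℕ) (y : Rd d) :
    multiDeriv β (fbiKernel z) y = ∏ j, iteratedDeriv (β j) (kernelOne (z j)) (y j : ℂ) := by
  have hit : ∀ (i : Fin d) (m : ℕ) (n : Fin d → ℕ),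
      (partialDeriv i)^[m]
        (fun y : Rd d => ∏ j, iteratedDeriv (n j) (kernelOne (z j)) (y j : ℂ)) =
      fun y : Rd d => ∏ j, iteratedDeriv (Function.update n i (n i + m) j)
        (kernelOne (z j)) (y j : ℂ) := by
    intro i m n
    induction m with
    | zero => simp
    | succ m ih =>
      rw [Function.iterate_succ_apply', ih, partialDeriv_prod]
      simp [add_assoc]
  have main : ∀ l : List (Fin d), l.Nodup →
      l.foldr (fun i g => (partialDeriv i)^[β i] g) (fbiKernel z) =
      fun y : Rd d => ∏ j, iteratedDeriv (if j ∈ l then β j else 0)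
        (kernelOne (z j)) (y j : ℂ) := by
    intro l hl
    induction l with
    | nil =>
      funext y
      simp [fbiKernel_eq_prod]
    | cons i l ih =>
      rw [List.nodup_cons] at hl
      rw [List.foldr_cons, ih hl.2, hit i (β i) (fun j => if j ∈ l then β j else 0)]
      funext y
      refine Finset.prod_congr rfl fun j _ => ?_
      by_cases hj : j = i
      · subst hj
        simp [hl.1]
      · simp [hj]
  have := congrFun (main _ (List.nodup_finRange d)) y
  simpa [multiDeriv] using this

theorem norm_kernelOne_le (z : ℂ) (t r : ℝ) (w : ℂ) (hw : ‖w - t‖ = r) :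
    ‖kernelOne z w‖ ≤ Real.exp (3 * ‖z‖ ^ 2 + 2 * r ^ 2 - t ^ 2 / 8) := by
  unfold kernelOne
  rw [Complex.norm_exp]
  refine Real.exp_le_exp.mpr ?_
  obtain ⟨h, rfl⟩ : ∃ h : ℂ, w = t + h := ⟨w - t, by ring⟩
  have hr : ‖h‖ = r := by simpa using hw
  have h1 : (Complex.I * z * (t + h)).re ≤ ‖z‖ * (|t| + r) := by
    refine (Complex.re_le_norm _).trans ?_
    rw [norm_mul, norm_mul, Complex.norm_I, one_mul]
    gcongr
    refine (norm_add_le _ _).trans ?_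
    simp [hr]
  have h2 : (((t : ℂ) + h) ^ 2 / 2).re = (t ^ 2 + 2 * t * h.re + (h.re ^ 2 - h.im ^ 2)) / 2 := by
    have : ((t : ℂ) + h) ^ 2 / 2 = (((1 / 2 : ℝ) : ℂ)) * (((t : ℂ) + h) * ((t : ℂ) + h)) := by
      push_cast
      ring
    rw [this, Complex.re_ofReal_mul]
    simp
    ring
  have h3 : h.re ^ 2 + h.im ^ 2 = r ^ 2 := by
    rw [← hr, Complex.sq_norm, Complex.normSq_apply]
    ring
  have h4 := sq_abs t
  rw [Complex.sub_re, h2]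
  nlinarith [sq_nonneg (t / 2 + h.re), sq_nonneg (‖z‖ - r), sq_nonneg (2 * ‖z‖ - |t| / 2),
    sq_nonneg h.re, sq_nonneg h.im, sq_nonneg (t + 2 * h.re), sq_nonneg ‖z‖]

theorem kernelOne_bound (z : ℂ) (a b : ℕ) (t : ℝ) :
    |t| ^ a * ‖iteratedDeriv b (kernelOne z) (t : ℂ)‖ ≤
      Real.exp (3 * ‖z‖ ^ 2 + 2) * Real.exp 2 ^ (a + b) * √(a ! : ℝ) * √(b ! : ℝ) := by
  set r : ℝ := √((b : ℝ) + 1) with hr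
  have hr0 : 0 < r := Real.sqrt_pos.mpr (by positivity)
  have hr2 : r ^ 2 = (b : ℝ) + 1 := Real.sq_sqrt (by positivity)
  have h1 := Complex.norm_iteratedDeriv_le_of_forall_mem_sphere_norm_le b hr0
    (f := kernelOne z) (c := (t : ℂ))
    (((contDiff_kernelOne z).differentiable (by simp)).diffContOnCl)
    (C := Real.exp (3 * ‖z‖ ^ 2 + 2 * r ^ 2 - t ^ 2 / 8))
    (fun w hw => norm_kernelOne_le z t r w (by simpa [dist_eq_norm] using hw))
  have h2 : (b ! : ℝ) / r ^ b ≤ √(b ! : ℝ) := by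
    rw [div_le_iff₀ (by positivity)]
    have h3 : √(b ! : ℝ) ≤ r ^ b := by
      refine Real.sqrt_le_iff.mpr ⟨by positivity, ?_⟩
      rw [← pow_mul, mul_comm b 2, pow_mul, hr2]
      calc (b ! : ℝ) ≤ (b : ℝ) ^ b := by exact_mod_cast Nat.factorial_le_pow b
        _ ≤ _ := by gcongr; linarith
    calc (b ! : ℝ) = √(b ! : ℝ) * √(b ! : ℝ) := (Real.mul_self_sqrt (by positivity)).symm
      _ ≤ _ := by gcongr
  have h4 : |t| ^ a * Real.exp (-(t ^ 2 / 8)) ≤ 2 ^ a * √(a ! : ℝ) := by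
    have h5 := Real.pow_div_factorial_le_exp (x := t ^ 2 / 4) (by positivity) a
    rw [div_le_iff₀ (by positivity)] at h5
    rw [Real.exp_neg, ← div_eq_mul_inv, div_le_iff₀ (Real.exp_pos _)]
    refine abs_le_of_sq_le_sq' ?_ (by positivity) |>.2
    have h6 : Real.exp (t ^ 2 / 8) ^ 2 = Real.exp (t ^ 2 / 4) := by
      rw [← Real.exp_nat_mul]
      congr 1
      push_cast
      ring
    have h7 : (|t| ^ a) ^ 2 = 4 ^ a * (t ^ 2 / 4) ^ a := by
      rw [← mul_pow, ← pow_mul, mul_comm a 2, pow_mul, sq_abs]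
      congr 1
      ring
    rw [mul_pow, mul_pow, h6, Real.sq_sqrt (by positivity), h7, ← pow_mul, mul_comm a 2, pow_mul]
    norm_num
    rw [mul_assoc]
    gcongr
    linarith
  have he2 : (2 : ℝ) ≤ Real.exp 2 := by linarith [Real.add_one_le_exp (2 : ℝ)]
  have h8 : Real.exp (3 * ‖z‖ ^ 2 + 2 * r ^ 2 - t ^ 2 / 8) =
      Real.exp (3 * ‖z‖ ^ 2 + 2) * Real.exp 2 ^ b * Real.exp (-(t ^ 2 / 8)) := by
    rw [← Real.exp_nat_mul, ← Real.exp_add, ← Real.exp_add, hr2]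
    congr 1
    ring
  calc |t| ^ a * ‖iteratedDeriv b (kernelOne z) (t : ℂ)‖
      ≤ |t| ^ a * ((b ! : ℝ) * Real.exp (3 * ‖z‖ ^ 2 + 2 * r ^ 2 - t ^ 2 / 8) / r ^ b) := by
        gcongr
    _ = Real.exp (3 * ‖z‖ ^ 2 + 2) * Real.exp 2 ^ b * (|t| ^ a * Real.exp (-(t ^ 2 / 8))) *
          ((b ! : ℝ) / r ^ b) := by
        rw [h8]
        ring
    _ ≤ Real.exp (3 * ‖z‖ ^ 2 + 2) * Real.exp 2 ^ b * (Real.exp 2 ^ a * √(a ! : ℝ)) *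
          √(b ! : ℝ) := by
        have h9 : |t| ^ a * Real.exp (-(t ^ 2 / 8)) ≤ Real.exp 2 ^ a * √(a ! : ℝ) :=
          h4.trans (by gcongr)
        exact mul_le_mul (mul_le_mul_of_nonneg_left h9 (by positivity)) h2 (by positivity)
          (by positivity)
    _ = _ := by
        rw [pow_add]
        ring

theorem fbiKernel_mem {d : ℕ} {θ : ℝ} (hθ : 1 / 2 ≤ θ) (z : Cd d) : fbiKernel z ∈ GS θ d := by
  refine ⟨?_, Real.exp 2, Real.exp_pos _, ∏ j, Real.exp (3 * ‖z j‖ ^ 2 + 2), fun α β y => ?_⟩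
  · have h := contDiff_kernel_prod z (fun _ => 0)
    have h2 : (fun y : Rd d => ∏ j, iteratedDeriv 0 (kernelOne (z j)) (y j : ℂ)) = fbiKernel z := by
      funext y
      simp [fbiKernel_eq_prod]
    rwa [h2] at h
  · have hs : ∀ m : ℕ, √(m ! : ℝ) ≤ (m ! : ℝ) ^ θ := fun m => by
      rw [Real.sqrt_eq_rpow]
      exact Real.rpow_le_rpow_of_exponent_le (by exact_mod_cast m.factorial_pos) hθ
    rw [multiDeriv_fbiKernel, norm_mul, Complex.norm_real, norm_prod, norm_prod,
      ← Finset.prod_mul_distrib]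
    push_cast
    rw [← Real.finsetProd_rpow _ _ (fun j _ => by positivity),
      ← Real.finsetProd_rpow _ _ (fun j _ => by positivity), ← Finset.sum_add_distrib,
      ← Finset.prod_pow_eq_pow_sum, ← Finset.prod_mul_distrib, ← Finset.prod_mul_distrib,
      ← Finset.prod_mul_distrib]
    refine Finset.prod_le_prod (fun j _ => by positivity) fun j _ => ?_
    rw [norm_pow, Real.norm_eq_abs]
    refine (kernelOne_bound (z j) (α j) (β j) (y j)).trans ?_
    gcongr
    · exact hs _
    · exact hs _

/-! ### FBI transform, global wave front set -/

/-- The FBI transform `T u(z) = 2^{-d/2} π^{-3d/4} ⟨u_y, e^{iφ(z,y)}⟩`, `z ∈ ℂ^d`, with the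
standard phase `φ(z,y) = ⟨z,y⟩ + (i/2)|y|²`. -/
noncomputable def fbi {d : ℕ} {θ : ℝ} (hθ : 1 / 2 ≤ θ) (u : GSDual θ d) (z : Cd d) : ℂ :=
  (((2 : ℝ) ^ (-(d : ℝ) / 2) * Real.pi ^ (-(3 * d : ℝ) / 4) : ℝ) : ℂ) *
    u.1 ⟨fbiKernel z, fbiKernel_mem hθ z⟩

/-- The weight `Φ(z) = |Im z|²/2 = max_y (-Im φ(z,y))`. -/
noncomputable def fbiWeight {d : ℕ} (z : Cd d) : ℝ := (∑ j, (z j).im ^ 2) / 2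

/-- The linear bijection `(x,ξ) ↦ -ξ - ix` of `T^*ℝ^d` onto `ℂ^d`, that is
`(y, -φ'_y(z,y)) ↦ z`. -/
noncomputable def chi {d : ℕ} (p : Rd d × Rd d) : Cd d :=
  WithLp.toLp 2 fun j => -(p.2 j : ℂ) - Complex.I * (p.1 j : ℂ)

/-- A subset of `ℂ^d` is conic if it is invariant under multiplication by positive reals. -/
def IsConic {d : ℕ} (Γ : Set (Cd d)) : Prop := ∀ t : ℝ, 0 < t → ∀ z ∈ Γ, (t : ℂ) • z ∈ Γ

/-- The global wave front set `WF^θ_gl(u) ⊆ T^*ℝ^d ∖ {0}`. -/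
noncomputable def WFgl {d : ℕ} {θ : ℝ} (hθ : 1 / 2 ≤ θ) (u : GSDual θ d) : Set (Rd d × Rd d) :=
  {p | p ≠ 0 ∧ ¬ ∃ Γ : Set (Cd d), IsOpen Γ ∧ IsConic Γ ∧ chi p ∈ Γ ∧
    ∃ ε > 0, ∃ C : ℝ, ∀ z ∈ Γ, ‖fbi hθ u z‖ ≤ C * Real.exp (-ε * ‖z‖ ^ (1 / θ) + fbiWeight z)}

/-! ### Short-time Fourier transform and localization operators -/

/-- The standard Gaussian window `ψ(y) = π^{-d/4} e^{-|y|²/2}`, normalized in `L²`. -/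
noncomputable def gaussWindow {d : ℕ} (y : Rd d) : ℝ :=
  Real.pi ^ (-(d : ℝ) / 4) * Real.exp (-‖y‖ ^ 2 / 2)

/-- The time-frequency shift `y ↦ ψ(y - x) e^{-i⟨ξ,y⟩}`, with `p = (x,ξ)`. -/
noncomputable def gaborAtom {d : ℕ} (p : Rd d × Rd d) (y : Rd d) : ℂ :=
  (gaussWindow (y - p.1) : ℂ) * Complex.exp (-(Complex.I * (inner ℝ p.2 y : ℝ)))

theorem gaborAtom_eq {d : ℕ} (p : Rd d × Rd d) :
    gaborAtom p = (((Real.pi ^ (-(d : ℝ) / 4) * Real.exp (-‖p.1‖ ^ 2 / 2) : ℝ)) : ℂ) •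
      fbiKernel (chi p) := by
  funext y
  have h1 : (∑ j, chi p j * (y j : ℂ)) =
      -((inner ℝ p.2 y : ℝ) : ℂ) - Complex.I * ((inner ℝ p.1 y : ℝ) : ℂ) := by
    simp only [chi, PiLp.inner_apply, RCLike.inner_apply, conj_trivial]
    push_cast
    rw [Finset.mul_sum, ← Finset.sum_neg_distrib, ← Finset.sum_sub_distrib]
    exact Finset.sum_congr rfl fun j _ => by ring
  have h2 : ‖y - p.1‖ ^ 2 = ‖y‖ ^ 2 - 2 * inner ℝ p.1 y + ‖p.1‖ ^ 2 := by
    rw [norm_sub_sq_real, real_inner_comm]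
  simp only [gaborAtom, gaussWindow, fbiKernel, Pi.smul_apply, smul_eq_mul, h1, h2]
  push_cast
  rw [mul_assoc, mul_assoc, ← Complex.exp_add, ← Complex.exp_add]
  congr 2
  linear_combination ((inner ℝ p.1 y : ℂ) - (‖y‖ : ℂ) ^ 2 / 2) * Complex.I_mul_I

theorem gaborAtom_mem {d : ℕ} {θ : ℝ} (hθ : 1 / 2 ≤ θ) (p : Rd d × Rd d) :
    gaborAtom p ∈ GS θ d := by
  rw [gaborAtom_eq]
  exact (GS θ d).smul_mem _ (fbiKernel_mem hθ _)

/-- The short-time Fourier transform `V_ψ u(x,ξ) = (2π)^{-d/2} ⟨u, ψ(· - x) e^{-i⟨ξ,·⟩}⟩` of an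
ultradistribution. -/
noncomputable def stftDual {d : ℕ} {θ : ℝ} (hθ : 1 / 2 ≤ θ) (u : GSDual θ d)
    (p : Rd d × Rd d) : ℂ :=
  (((2 * Real.pi) ^ (-(d : ℝ) / 2) : ℝ) : ℂ) * u.1 ⟨gaborAtom p, gaborAtom_mem hθ p⟩

/-- The short-time Fourier transform
`V_ψ f(x,ξ) = (2π)^{-d/2} ∫ f(y) ψ(y - x) e^{-i⟨ξ,y⟩} dy` of a function. -/
noncomputable def stftFun {d : ℕ} (f : Rd d → ℂ) (p : Rd d × Rd d) : ℂ :=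
  (((2 * Real.pi) ^ (-(d : ℝ) / 2) : ℝ) : ℂ) * ∫ y, f y * gaborAtom p y

/-- `A` is the localization operator `A_a^ψ = V_ψ^* a V_ψ` on `S_θ'(ℝ^d)`, given weakly by
`(A u, g) = ∫ a V_ψ u \overline{V_ψ g} dx dξ` with the pairing `(w, g)` linear in `w` and
antilinear in `g`; here `g = \overline{f}`, so that `(A u, g) = (A u)(f)`. -/
def IsLocalizationOperator {d : ℕ} {θ : ℝ} (hθ : 1 / 2 ≤ θ) (a : Rd d × Rd d → ℂ)
    (A : GSDual θ d →ₗ[ℂ] GSDual θ d) : Prop :=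
  ∀ (u : GSDual θ d) (f : GS θ d),
    Integrable (fun p : Rd d × Rd d =>
      a p * stftDual hθ u p * conj (stftFun (fun y => conj ((f : Rd d → ℂ) y)) p)) ∧
    (A u).1 f = ∫ p : Rd d × Rd d,
      a p * stftDual hθ u p * conj (stftFun (fun y => conj ((f : Rd d → ℂ) y)) p)

end GelfandShilov

open GelfandShilov

/-!
Up to the factor `e^{-|Im z|²/2}`, the FBI transform is the short-time Fourier transform read at
`z = chi p`, so `WF_gl^θ(u)` is the set of directions around which `V_ψ u` has no decay
`e^{-ε|p|^{1/θ}}` in a cone.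

Every `u ∈ S_θ'` has `V_ψ u = O(e^{δ|p|^{1/θ}})` for every `δ > 0`, because the seminorms of the
Gabor atoms grow no faster; the atoms being tensor products, this follows from Cauchy's estimates
in one variable. For `f ∈ S_θ`, integration by parts bounds all the moments of `V_ψ f`, hence
`V_ψ f = O(e^{-ε|p|^{1/θ}})` for some `ε > 0`. So `F = a V_ψ u` is subexponential and
`V_ψ^* F ∈ S_θ'`.

The kernel of `V_ψ V_ψ^*` is bounded by a multiple of `e^{-|p-q|²/4}`. Let `F` decay on a cone `Γ`,
and let `q` lie in a smaller cone. For `p ∈ Γ` half of the Gaussian turns the decay of `F p` into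
decay in `q`; for `p ∉ Γ` one has `|p - q| ≥ c|q|`, and since `1/θ ≤ 2` the Gaussian absorbs the
growth of `F p` and still decays in `q`.
-/

namespace GelfandShilov

variable {d : ℕ} {θ : ℝ}

/-! ### Powers, factorials and exponentials -/

theorem rpow_one_div_rpow_self {s : ℝ} (hθ : θ ≠ 0) (hs : 0 ≤ s) : (s ^ (1 / θ)) ^ θ = s := by
  rw [← Real.rpow_mul hs, one_div_mul_cancel hθ, Real.rpow_one]

theorem exists_pow_le_factorial_rpow_mul_exp {δ : ℝ} (hθ : 0 < θ) (hδ : 0 < δ) :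
    ∃ H : ℝ, 1 ≤ H ∧ ∀ (k : ℕ) (s : ℝ), 0 ≤ s →
      s ^ k ≤ H ^ k * (k ! : ℝ) ^ θ * Real.exp (δ * s ^ (1 / θ)) := by
  refine ⟨max 1 ((θ / δ) ^ θ), le_max_left _ _, fun k s hs => ?_⟩
  set σ : ℝ := s ^ (1 / θ)
  have hσ : 0 ≤ σ := by positivity
  have hexp : σ ^ k ≤ (θ / δ) ^ k * (k ! * Real.exp (δ / θ * σ)) := by
    calc σ ^ k = (θ / δ) ^ k * (δ / θ * σ) ^ k := by
          rw [← mul_pow]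
          congr 1
          field_simp
      _ ≤ _ := by
          gcongr
          rw [← div_le_iff₀' (by positivity)]
          exact Real.pow_div_factorial_le_exp _ (by positivity) k
  have hpow := Real.rpow_le_rpow (by positivity) hexp hθ.le
  rw [Real.mul_rpow (by positivity) (by positivity), Real.mul_rpow (by positivity) (by positivity),
    ← Real.exp_mul, ← Real.rpow_pow_comm hσ, ← Real.rpow_pow_comm (by positivity),
    rpow_one_div_rpow_self hθ.ne' hs, mul_right_comm, div_mul_cancel₀ _ hθ.ne'] at hpow
  rw [mul_assoc]
  refine hpow.trans ?_
  gcongr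
  exact le_max_right _ _

theorem le_two_mul_exp_neg_of_forall_pow_mul_le {σ v b Q : ℝ} (hQ : 0 < Q)
    (h : ∀ n : ℕ, σ ^ n * v ≤ b * Q ^ n * n !) : v ≤ 2 * b * Real.exp (-(σ / (2 * Q))) := by
  have hterm : ∀ n : ℕ, (σ / (2 * Q)) ^ n / n ! * v ≤ b * (1 / 2) ^ n := fun n => by
    calc (σ / (2 * Q)) ^ n / n ! * v = σ ^ n * v / ((2 * Q) ^ n * n !) := by
          rw [div_pow]
          field_simp
      _ ≤ b * Q ^ n * n ! / ((2 * Q) ^ n * n !) := by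
          gcongr ?_ / _
          exact h n
      _ = b * (1 / 2) ^ n := by
          rw [mul_pow, one_div, inv_pow]
          field_simp
  have hexp : HasSum (fun n : ℕ => (σ / (2 * Q)) ^ n / n ! * v) (Real.exp (σ / (2 * Q)) * v) := by
    rw [Real.exp_eq_exp_ℝ]
    exact (NormedSpace.expSeries_div_hasSum_exp (σ / (2 * Q))).mul_right v
  have hsum := hasSum_le hterm hexp (hasSum_geometric_two.mul_left b)
  rw [Real.exp_neg, ← div_eq_mul_inv, le_div_iff₀ (Real.exp_pos _)]
  linarith

theorem exists_le_exp_neg_of_forall_pow_mul_le {A : ℝ} (hθ : 0 < θ) (hA : 0 < A) :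
    ∃ ε > 0, ∃ K : ℝ, 0 ≤ K ∧ ∀ s w B : ℝ, 0 ≤ s → 0 ≤ w →
      (∀ n : ℕ, s ^ n * w ≤ B * A ^ n * (n ! : ℝ) ^ θ) →
      w ≤ K * B * Real.exp (-ε * s ^ (1 / θ)) := by
  refine ⟨θ / (2 * A ^ (1 / θ)), by positivity, 2 ^ θ, by positivity, fun s w B hs hw h => ?_⟩
  have hB : 0 ≤ B := by
    have h0 := h 0
    simp only [pow_zero, one_mul, Nat.factorial_zero, Nat.cast_one, Real.one_rpow, mul_one] at h0
    exact hw.trans h0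
  have hroot : ∀ n : ℕ, (s ^ (1 / θ)) ^ n * w ^ (1 / θ) ≤
      B ^ (1 / θ) * (A ^ (1 / θ)) ^ n * n ! := fun n => by
    have hn := Real.rpow_le_rpow (by positivity) (h n) (one_div_pos.mpr hθ).le
    rwa [Real.mul_rpow (by positivity) hw, Real.mul_rpow (by positivity) (by positivity),
      Real.mul_rpow hB (by positivity), ← Real.rpow_pow_comm hs, ← Real.rpow_pow_comm hA.le,
      ← Real.rpow_mul (by positivity), mul_one_div_cancel hθ.ne', Real.rpow_one] at hn
  have hdecay := Real.rpow_le_rpow (by positivity)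
    (le_two_mul_exp_neg_of_forall_pow_mul_le (by positivity) hroot) hθ.le
  rw [rpow_one_div_rpow_self hθ.ne' hw, Real.mul_rpow (by positivity) (by positivity),
    Real.mul_rpow (by norm_num) (by positivity), rpow_one_div_rpow_self hθ.ne' hB,
    ← Real.exp_mul] at hdecay
  refine hdecay.trans_eq ?_
  congr 2
  field_simp

theorem exists_norm_le_sqrt_mul_abs_apply [NeZero d] (v : Rd d) : ∃ j, ‖v‖ ≤ √d * |v j| := by
  obtain ⟨j, hj⟩ := Finite.exists_max fun j => |v j|
  refine ⟨j, ?_⟩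
  rw [EuclideanSpace.norm_eq, ← Real.sqrt_sq (abs_nonneg (v j)), ← Real.sqrt_mul d.cast_nonneg]
  refine Real.sqrt_le_sqrt ?_
  calc ∑ i, ‖v i‖ ^ 2 ≤ ∑ _i : Fin d, |v j| ^ 2 := by
        gcongr with i
        exact hj i
    _ = d * |v j| ^ 2 := by simp

theorem exists_le_exp_neg_norm_of_forall_coord (d : ℕ) {A : ℝ} (hθ : 0 < θ) (hA : 0 < A) :
    ∃ ε > 0, ∃ K : ℝ, 0 ≤ K ∧ ∀ (v : Rd d) (w B : ℝ), 0 ≤ w → w ≤ B →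
      (∀ (j : Fin d) (n : ℕ), |v j| ^ n * w ≤ B * A ^ n * (n ! : ℝ) ^ θ) →
      w ≤ K * B * Real.exp (-ε * ‖v‖ ^ (1 / θ)) := by
  rcases eq_or_ne d 0 with rfl | hd
  · refine ⟨1, one_pos, 1, zero_le_one, fun v w B _ hwB _ => ?_⟩
    simpa [Subsingleton.elim v 0, Real.zero_rpow (inv_pos.mpr hθ).ne'] using hwB
  have : NeZero d := ⟨hd⟩
  obtain ⟨ε, hε, K, hK, hdecay⟩ :=
    exists_le_exp_neg_of_forall_pow_mul_le hθ (A := √d * A) (by positivity)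
  refine ⟨ε, hε, K, hK, fun v w B hw _ h => hdecay ‖v‖ w B (norm_nonneg v) hw fun n => ?_⟩
  obtain ⟨j, hj⟩ := exists_norm_le_sqrt_mul_abs_apply v
  calc ‖v‖ ^ n * w ≤ (√d * |v j|) ^ n * w := by gcongr
    _ = √d ^ n * (|v j| ^ n * w) := by ring
    _ ≤ √d ^ n * (B * A ^ n * (n ! : ℝ) ^ θ) := by
        gcongr _ * ?_
        exact h j n
    _ = _ := by ring

theorem integrable_exp_neg_mul_norm_rpow {E : Type*} [NormedAddCommGroup E] [NormedSpace ℝ E]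
    [FiniteDimensional ℝ E] [MeasurableSpace E] [BorelSpace E] (μ : Measure E)
    [μ.IsAddHaarMeasure] {ε : ℝ} (hθ : 0 < θ) (hε : 0 < ε) :
    Integrable (fun p : E => Real.exp (-ε * ‖p‖ ^ (1 / θ))) μ := by
  obtain ⟨H, -, hH⟩ := exists_pow_le_factorial_rpow_mul_exp hθ hε
  set N : ℕ := Module.finrank ℝ E + 1 with hN
  have hint := integrable_one_add_norm (E := E) (μ := μ) (r := (N : ℝ))
    (by rw [hN]; push_cast; linarith)
  have hcont : Continuous fun p : E => Real.exp (-ε * ‖p‖ ^ (1 / θ)) :=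
    Real.continuous_exp.comp (continuous_const.mul
      (continuous_norm.rpow_const fun _ => Or.inr (by positivity)))
  refine (hint.const_mul (2 ^ (N - 1) * (1 + H ^ N * (N ! : ℝ) ^ θ))).mono'
    hcont.aestronglyMeasurable (Filter.Eventually.of_forall fun p => ?_)
  rw [Real.norm_of_nonneg (Real.exp_pos _).le, Real.rpow_neg (by positivity), Real.rpow_natCast,
    ← div_eq_mul_inv, le_div_iff₀ (by positivity), neg_mul, Real.exp_neg, mul_comm,
    ← div_eq_mul_inv, div_le_iff₀ (Real.exp_pos _), mul_assoc]
  refine (add_pow_le zero_le_one (norm_nonneg p) N).trans ?_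
  gcongr
  rw [add_mul, one_mul, one_pow]
  exact add_le_add (Real.one_le_exp (by positivity)) (hH N ‖p‖ (norm_nonneg _))

theorem rpow_one_div_le_one_add_sq (hθ : 1 / 2 ≤ θ) {s : ℝ} (hs : 0 ≤ s) :
    s ^ (1 / θ) ≤ 1 + s ^ 2 := by
  have hθ0 : 0 < θ := by linarith
  rcases le_total s 1 with h | h
  · have := Real.rpow_le_one hs h (one_div_pos.mpr hθ0).le
    nlinarith [sq_nonneg s]
  · have : s ^ (1 / θ) ≤ s ^ (2 : ℝ) := by
      refine Real.rpow_le_rpow_of_exponent_le h ?_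
      rw [div_le_iff₀ hθ0]
      linarith
    rw [Real.rpow_two] at this
    linarith

theorem add_rpow_one_div_le (hθ : 1 / 2 ≤ θ) {s t : ℝ} (hs : 0 ≤ s) (ht : 0 ≤ t) :
    (s + t) ^ (1 / θ) ≤ 4 * (s ^ (1 / θ) + t ^ (1 / θ)) := by
  have hθ0 : 0 < θ := by linarith
  have hdouble : (2 * max s t) ^ (1 / θ) ≤ 4 * max s t ^ (1 / θ) := by
    rw [Real.mul_rpow (by norm_num) (by positivity)]
    gcongr
    calc (2 : ℝ) ^ (1 / θ) ≤ 2 ^ (2 : ℝ) := by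
          refine Real.rpow_le_rpow_of_exponent_le (by norm_num) ?_
          rw [div_le_iff₀ hθ0]
          linarith
      _ = 4 := by norm_num
  have hmax : max s t ^ (1 / θ) ≤ s ^ (1 / θ) + t ^ (1 / θ) := by
    rcases max_choice s t with h | h <;> rw [h] <;>
      linarith [Real.rpow_nonneg hs (1 / θ), Real.rpow_nonneg ht (1 / θ)]
  calc (s + t) ^ (1 / θ) ≤ (2 * max s t) ^ (1 / θ) := by
        gcongr
        linarith [le_max_left s t, le_max_right s t]
    _ ≤ 4 * max s t ^ (1 / θ) := hdouble
    _ ≤ _ := by gcongr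

theorem norm_rpow_one_div_le_of_sub {E : Type*} [SeminormedAddCommGroup E] (hθ : 1 / 2 ≤ θ)
    (v w : E) : ‖v‖ ^ (1 / θ) ≤ 4 * (‖w‖ ^ (1 / θ) + (1 + ‖v - w‖ ^ 2)) := by
  calc ‖v‖ ^ (1 / θ) ≤ (‖w‖ + ‖v - w‖) ^ (1 / θ) := by
        gcongr
        exact norm_le_norm_add_norm_sub' v w
    _ ≤ 4 * (‖w‖ ^ (1 / θ) + ‖v - w‖ ^ (1 / θ)) :=
        add_rpow_one_div_le hθ (norm_nonneg _) (norm_nonneg _)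
    _ ≤ _ := by
        gcongr
        exact rpow_one_div_le_one_add_sq hθ (norm_nonneg _)

theorem factorial_rpow_mul_le (hθ : 0 ≤ θ) (k l : ℕ) :
    (k ! : ℝ) ^ θ * (l ! : ℝ) ^ θ ≤ ((k + l)! : ℝ) ^ θ := by
  rw [← Real.mul_rpow (by positivity) (by positivity)]
  gcongr
  exact_mod_cast Nat.le_of_dvd (Nat.factorial_pos _)
    (Nat.factorial_mul_factorial_dvd_factorial_add k l)

theorem integrable_exp_neg_mul_norm_sub_sq {V : Type*} [NormedAddCommGroup V]
    [InnerProductSpace ℝ V] [FiniteDimensional ℝ V] [MeasurableSpace V] [BorelSpace V]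
    {b : ℝ} (hb : 0 < b) (x : V) : Integrable fun y : V => Real.exp (-b * ‖y - x‖ ^ 2) := by
  have h := GaussianFourier.integrable_cexp_neg_mul_sq_norm_add (V := V) (b := (b : ℂ))
    (by simpa using hb) 0 0
  refine Integrable.comp_sub_right (f := fun y : V => Real.exp (-b * ‖y‖ ^ 2)) ?_ x
  refine h.norm.congr (Filter.Eventually.of_forall fun y => ?_)
  simp only [zero_mul, add_zero, Complex.norm_exp]
  norm_cast

theorem norm_integral_le_of_norm_le_gaussian {V E : Type*} [NormedAddCommGroup V]
    [InnerProductSpace ℝ V] [FiniteDimensional ℝ V] [MeasurableSpace V] [BorelSpace V]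
    [NormedAddCommGroup E] [NormedSpace ℝ E] {F : V → E} {b D : ℝ} (hb : 0 < b) (x : V)
    (hF : ∀ y, ‖F y‖ ≤ D * Real.exp (-b * ‖y - x‖ ^ 2)) :
    ‖∫ y, F y‖ ≤ D * ∫ y : V, Real.exp (-b * ‖y‖ ^ 2) := by
  calc ‖∫ y, F y‖ ≤ ∫ y : V, D * Real.exp (-b * ‖y - x‖ ^ 2) :=
        norm_integral_le_of_norm_le ((integrable_exp_neg_mul_norm_sub_sq hb x).const_mul D)
          (Filter.Eventually.of_forall hF)
    _ = _ := by
        rw [integral_const_mul,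
          integral_sub_right_eq_self (fun y : V => Real.exp (-b * ‖y‖ ^ 2)) x]

/-! ### Gelfand-Shilov estimates in one variable -/

/-- The one-variable analogue of `GSBound` for an entire function `g`: on the real line,
`sup_{a,b,t} h^{-a-b} (a!)^{-θ} (b!)^{-θ} |t^a g^{(b)}(t)| ≤ M`. Estimates on `ℝ^d` for tensor
products are reduced to it. -/
def LineBound (θ h M : ℝ) (g : ℂ → ℂ) : Prop :=
  ∀ (a b : ℕ) (t : ℝ),
    |t| ^ a * ‖iteratedDeriv b g t‖ ≤ M * h ^ (a + b) * (a ! : ℝ) ^ θ * (b ! : ℝ) ^ θ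

namespace LineBound

variable {θ' h M M' : ℝ} {g : ℂ → ℂ}

theorem nonneg (hg : LineBound θ h M g) : 0 ≤ M := by
  have h0 := (norm_nonneg _).trans ((one_mul _).symm.trans_le (hg 0 0 0))
  simpa using h0

theorem norm_iteratedDeriv_le (hg : LineBound θ h M g) (b : ℕ) (t : ℝ) :
    ‖iteratedDeriv b g t‖ ≤ M * h ^ b * (b ! : ℝ) ^ θ := by
  simpa using hg 0 b t

theorem mono (hg : LineBound θ h M g) (hθ : θ ≤ θ') (hh : 0 ≤ h) (hM : M ≤ M') :
    LineBound θ' h M' g := by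
  have hfac : ∀ n : ℕ, (n ! : ℝ) ^ θ ≤ (n ! : ℝ) ^ θ' := fun n =>
    Real.rpow_le_rpow_of_exponent_le (by exact_mod_cast n.factorial_pos) hθ
  have hM0 : 0 ≤ M' := hg.nonneg.trans hM
  intro a b t
  refine (hg a b t).trans ?_
  gcongr ?_ * _ * ?_ * ?_
  exacts [hfac a, hfac b]

end LineBound

theorem differentiable_kernelOne (z : ℂ) : Differentiable ℂ (kernelOne z) :=
  (contDiff_kernelOne z).differentiable (by simp)

theorem lineBound_kernelOne (hθ : 1 / 2 ≤ θ) (z : ℂ) :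
    LineBound θ (Real.exp 2) (Real.exp (3 * ‖z‖ ^ 2 + 2)) (kernelOne z) := by
  refine LineBound.mono (θ := 1 / 2) (fun a b t => ?_) hθ (Real.exp_pos _).le le_rfl
  simpa only [Real.sqrt_eq_rpow] using kernelOne_bound z a b t

theorem factorial_div_sqrt_succ_pow_le (b : ℕ) :
    (b ! : ℝ) / √((b : ℝ) + 1) ^ b ≤ √(b ! : ℝ) := by
  rw [div_le_iff₀ (by positivity)]
  have hroot : √(b ! : ℝ) ≤ √((b : ℝ) + 1) ^ b := by
    refine Real.sqrt_le_iff.mpr ⟨by positivity, ?_⟩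
    rw [← pow_mul, mul_comm b 2, pow_mul, Real.sq_sqrt (by positivity)]
    calc (b ! : ℝ) ≤ (b : ℝ) ^ b := by exact_mod_cast Nat.factorial_le_pow b
      _ ≤ ((b : ℝ) + 1) ^ b := by gcongr; linarith
  calc (b ! : ℝ) = √(b ! : ℝ) * √(b ! : ℝ) := (Real.mul_self_sqrt (by positivity)).symm
    _ ≤ _ := by gcongr

theorem norm_iteratedDeriv_le_of_gaussian_growth {g : ℂ → ℂ} (hg : Differentiable ℂ g) {D ρ : ℝ}
    {c : ℂ} (hD : ∀ w, ‖g w‖ ≤ D * Real.exp (ρ * ‖w - c‖ ^ 2)) (b : ℕ) :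
    ‖iteratedDeriv b g c‖ ≤ D * Real.exp ρ ^ (b + 1) * √(b ! : ℝ) := by
  have hD0 : 0 ≤ D := by simpa using (norm_nonneg _).trans (hD c)
  -- Cauchy's estimate on the circle of radius `√(b + 1)`, which balances `b!` and `exp (ρ r ^ 2)`
  set r : ℝ := √((b : ℝ) + 1)
  have hr : r ^ 2 = (b : ℝ) + 1 := Real.sq_sqrt (by positivity)
  have hexp : Real.exp (ρ * r ^ 2) = Real.exp ρ ^ (b + 1) := by
    rw [hr, ← Real.exp_nat_mul]
    push_cast
    ring_nf
  calc ‖iteratedDeriv b g c‖ ≤ (b ! : ℝ) * (D * Real.exp (ρ * r ^ 2)) / r ^ b := by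
        refine Complex.norm_iteratedDeriv_le_of_forall_mem_sphere_norm_le b (by positivity)
          hg.diffContOnCl fun w hw => ?_
        have hw' := hD w
        rwa [← dist_eq_norm, Metric.mem_sphere.mp hw] at hw'
    _ = D * Real.exp ρ ^ (b + 1) * ((b ! : ℝ) / r ^ b) := by
        rw [hexp]
        ring
    _ ≤ _ := by
        gcongr
        exact factorial_div_sqrt_succ_pow_le b

theorem exists_lineBound_of_gaussian_growth (hθ : 1 / 2 ≤ θ) {κ ρ : ℝ} (hκ : 0 < κ)
    (hρ : 0 ≤ ρ) :
    ∃ h : ℝ, 1 ≤ h ∧ ∀ (g : ℂ → ℂ) (D : ℝ), Differentiable ℂ g →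
      (∀ (t : ℝ) (w : ℂ), ‖g w‖ ≤ D * Real.exp (-κ * t ^ 2) * Real.exp (ρ * ‖w - t‖ ^ 2)) →
      LineBound θ h (D * Real.exp ρ) g := by
  obtain ⟨H, hH1, hH⟩ := exists_pow_le_factorial_rpow_mul_exp one_half_pos hκ
  have he : 1 ≤ Real.exp ρ := Real.one_le_exp hρ
  refine ⟨H * Real.exp ρ, by nlinarith, fun g D hg hD => ?_⟩
  have hD0 : 0 ≤ D := by simpa using (norm_nonneg _).trans (hD 0 0)
  refine LineBound.mono (θ := 1 / 2) (fun a b t => ?_) hθ (by positivity) le_rfl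
  have hpow : |t| ^ a * Real.exp (-κ * t ^ 2) ≤ H ^ a * (a ! : ℝ) ^ (1 / 2 : ℝ) := by
    have := hH a |t| (abs_nonneg t)
    rw [one_div_one_div, Real.rpow_two, sq_abs] at this
    rwa [neg_mul, Real.exp_neg, ← div_eq_mul_inv, div_le_iff₀ (Real.exp_pos _)]
  calc |t| ^ a * ‖iteratedDeriv b g t‖
      ≤ |t| ^ a * (D * Real.exp (-κ * t ^ 2) * Real.exp ρ ^ (b + 1) * √(b ! : ℝ)) := by
        gcongr
        exact norm_iteratedDeriv_le_of_gaussian_growth hg (hD t) b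
    _ = D * Real.exp ρ * Real.exp ρ ^ b * (|t| ^ a * Real.exp (-κ * t ^ 2)) *
          (b ! : ℝ) ^ (1 / 2 : ℝ) := by
        rw [Real.sqrt_eq_rpow]
        ring
    _ ≤ D * Real.exp ρ * (H * Real.exp ρ) ^ b *
          ((H * Real.exp ρ) ^ a * (a ! : ℝ) ^ (1 / 2 : ℝ)) * (b ! : ℝ) ^ (1 / 2 : ℝ) := by
        gcongr _ * ?_ ^ b * ?_ * _
        · exact le_mul_of_one_le_left (by positivity) hH1
        · refine hpow.trans ?_
          gcongr
          exact le_mul_of_one_le_right (by positivity) he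
    _ = _ := by ring

theorem norm_kernelOne_sub_le {R : ℝ} {z z' : ℂ} (hz : ‖z‖ ≤ R) (hz' : ‖z'‖ ≤ R) (t : ℝ) (w : ℂ) :
    ‖kernelOne z w - kernelOne z' w‖ ≤
      ‖z - z'‖ * Real.exp (3 * R ^ 2 + 5) * Real.exp (-(1 / 16) * t ^ 2) *
        Real.exp (3 * ‖w - t‖ ^ 2) := by
  have hderiv : ∀ ζ : ℂ, HasDerivAt (fun ζ => kernelOne ζ w) (kernelOne ζ w * (Complex.I * w)) ζ :=
    fun ζ => HasDerivAt.cexp <| by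
      simpa using (((hasDerivAt_id ζ).const_mul Complex.I).mul_const w).sub_const (w ^ 2 / 2)
  have hw : ‖w‖ ≤ Real.exp (1 / 16 * t ^ 2 + ‖w - t‖ ^ 2 + 5) := by
    have hadd : ‖w‖ ≤ ‖w - t‖ + |t| := by
      simpa using norm_add_le (w - t) (t : ℂ)
    have hexp := Real.add_one_le_exp (1 / 16 * t ^ 2 + ‖w - t‖ ^ 2 + 5)
    nlinarith [sq_nonneg (|t| / 4 - 2), sq_nonneg (‖w - t‖ - 1 / 2), sq_abs t]
  have hbound : ∀ ζ ∈ Metric.closedBall (0 : ℂ) R, ‖kernelOne ζ w * (Complex.I * w)‖ ≤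
      Real.exp (3 * R ^ 2 + 5) * Real.exp (-(1 / 16) * t ^ 2) * Real.exp (3 * ‖w - t‖ ^ 2) := by
    intro ζ hζ
    have hζR : ‖ζ‖ ≤ R := by simpa using hζ
    have hζsq : ‖ζ‖ ^ 2 ≤ R ^ 2 := by gcongr
    rw [norm_mul, norm_mul, Complex.norm_I, one_mul]
    refine (mul_le_mul (norm_kernelOne_le ζ t _ w rfl) hw (norm_nonneg _)
      (Real.exp_pos _).le).trans ?_
    rw [← Real.exp_add, ← Real.exp_add, ← Real.exp_add]
    refine Real.exp_le_exp.mpr ?_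
    linarith
  refine ((convex_closedBall (0 : ℂ) R).norm_image_sub_le_of_norm_hasDerivWithin_le
    (fun ζ _ => (hderiv ζ).hasDerivWithinAt) hbound (by simpa using hz')
    (by simpa using hz)).trans_eq ?_
  ring

theorem exists_lineBound_kernelOne_sub (hθ : 1 / 2 ≤ θ) (R : ℝ) :
    ∃ h : ℝ, 1 ≤ h ∧ ∃ M : ℝ, 0 ≤ M ∧ ∀ z z' : ℂ, ‖z‖ ≤ R → ‖z'‖ ≤ R →
      LineBound θ h (‖z - z'‖ * M) (kernelOne z - kernelOne z') := by
  obtain ⟨h, hh, hline⟩ := exists_lineBound_of_gaussian_growth hθ (κ := 1 / 16) (ρ := 3)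
    (by norm_num) (by norm_num)
  refine ⟨h, hh, Real.exp (3 * R ^ 2 + 5) * Real.exp 3, by positivity, fun z z' hz hz' => ?_⟩
  rw [← mul_assoc]
  exact hline _ _ ((differentiable_kernelOne z).sub (differentiable_kernelOne z'))
    (norm_kernelOne_sub_le hz hz')

theorem norm_iteratedDeriv_kernelOne_zero_le (b : ℕ) (t : ℝ) :
    ‖iteratedDeriv b (kernelOne 0) (t : ℂ)‖ ≤
      Real.exp (-(1 / 8) * t ^ 2) * Real.exp 3 ^ (b + 1) * √(b ! : ℝ) := by
  refine norm_iteratedDeriv_le_of_gaussian_growth (differentiable_kernelOne 0) (fun w => ?_) b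
  refine (norm_kernelOne_le 0 t _ w rfl).trans ?_
  rw [← Real.exp_add, norm_zero]
  refine Real.exp_le_exp.mpr ?_
  nlinarith [sq_nonneg ‖w - t‖]

theorem exists_lineBound_comp_sub_const {δ h : ℝ} (hθ : 0 < θ) (hδ : 0 < δ) (hh : 1 ≤ h) :
    ∃ h' : ℝ, 1 ≤ h' ∧ ∀ (g : ℂ → ℂ) (M : ℝ), LineBound θ h M g → ∀ x : ℝ,
      LineBound θ h' (2 * M * Real.exp (δ * |x| ^ (1 / θ))) fun w => g (w - x) := by
  obtain ⟨H, hH1, hH⟩ := exists_pow_le_factorial_rpow_mul_exp hθ hδ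
  refine ⟨2 * H * h, by nlinarith, fun g M hg x a b t => ?_⟩
  have hM := hg.nonneg
  have hE : 1 ≤ Real.exp (δ * |x| ^ (1 / θ)) := Real.one_le_exp (by positivity)
  set E : ℝ := Real.exp (δ * |x| ^ (1 / θ))
  set F : ℝ := ‖iteratedDeriv b g ((t - x : ℝ) : ℂ)‖ with hF
  rw [iteratedDeriv_comp_sub_const]
  dsimp only
  rw [← Complex.ofReal_sub, ← hF]
  have hsplit : |t| ^ a ≤ 2 ^ a * (|x| ^ a + |t - x| ^ a) := by
    calc |t| ^ a ≤ (|x| + |t - x|) ^ a := by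
          gcongr
          simpa using abs_add_le x (t - x)
      _ ≤ 2 ^ (a - 1) * (|x| ^ a + |t - x| ^ a) := add_pow_le (abs_nonneg _) (abs_nonneg _) a
      _ ≤ _ := by
          gcongr
          · norm_num
          · exact Nat.sub_le a 1
  have hfar : |x| ^ a * F ≤ M * E * (H * h) ^ (a + b) * (a ! : ℝ) ^ θ * (b ! : ℝ) ^ θ := by
    calc |x| ^ a * F ≤ (H ^ a * (a ! : ℝ) ^ θ * E) * (M * h ^ b * (b ! : ℝ) ^ θ) := by
          gcongr
          exacts [hH a |x| (abs_nonneg _), hg.norm_iteratedDeriv_le b _]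
      _ ≤ ((H * h) ^ a * (a ! : ℝ) ^ θ * E) * (M * (H * h) ^ b * (b ! : ℝ) ^ θ) := by
          gcongr <;> nlinarith
      _ = _ := by ring
  have hnear : |t - x| ^ a * F ≤ M * E * (H * h) ^ (a + b) * (a ! : ℝ) ^ θ * (b ! : ℝ) ^ θ := by
    refine (hg a b (t - x)).trans ?_
    gcongr
    · exact le_mul_of_one_le_right hM hE
    · exact le_mul_of_one_le_left (by positivity) hH1
  calc |t| ^ a * F ≤ 2 ^ a * (|x| ^ a + |t - x| ^ a) * F := by gcongr
    _ = 2 ^ a * (|x| ^ a * F + |t - x| ^ a * F) := by ring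
    _ ≤ 2 ^ (a + b) * (M * E * (H * h) ^ (a + b) * (a ! : ℝ) ^ θ * (b ! : ℝ) ^ θ +
          M * E * (H * h) ^ (a + b) * (a ! : ℝ) ^ θ * (b ! : ℝ) ^ θ) := by
        gcongr
        · norm_num
        · exact Nat.le_add_right a b
    _ = _ := by
        rw [mul_assoc 2 H, mul_pow 2]
        ring

theorem norm_iteratedDeriv_cexp_const_mul (n : ℕ) (ξ t : ℝ) :
    ‖iteratedDeriv n (fun w : ℂ => Complex.exp (-(Complex.I * ξ) * w)) t‖ = |ξ| ^ n := by
  have hphase : -(Complex.I * ξ) * t = ((-(ξ * t) : ℝ) : ℂ) * Complex.I := by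
    push_cast
    ring
  rw [iteratedDeriv_cexp_const_mul]
  dsimp only
  rw [hphase, norm_mul, Complex.norm_exp_ofReal_mul_I]
  simp

theorem mul_norm_iteratedDeriv_mul_le {f g : ℂ → ℂ} (hf : Differentiable ℂ f)
    (hg : Differentiable ℂ g) {b : ℕ} {z : ℂ} {c S : ℝ} (hc : 0 ≤ c)
    (h : ∀ i k, i + k = b → c * (‖iteratedDeriv i f z‖ * ‖iteratedDeriv k g z‖) ≤ S) :
    c * ‖iteratedDeriv b (f * g) z‖ ≤ 2 ^ b * S := by
  rw [iteratedDeriv_mul hf.contDiff.contDiffAt hg.contDiff.contDiffAt]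
  calc _ ≤ c * ∑ i ∈ Finset.range (b + 1),
          ‖(b.choose i : ℂ) * iteratedDeriv i f z * iteratedDeriv (b - i) g z‖ := by
        gcongr
        exact norm_sum_le _ _
    _ ≤ ∑ i ∈ Finset.range (b + 1), b.choose i * S := by
        rw [Finset.mul_sum]
        refine Finset.sum_le_sum fun i hi => ?_
        rw [norm_mul, norm_mul, Complex.norm_natCast, mul_assoc, mul_left_comm c]
        gcongr
        exact h i (b - i) (Nat.add_sub_cancel' (Nat.lt_succ_iff.mp (Finset.mem_range.mp hi)))
    _ = 2 ^ b * S := by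
        rw [← Finset.sum_mul]
        exact_mod_cast congrArg (fun n : ℕ => (n : ℝ) * S) (Nat.sum_range_choose b)

theorem exists_lineBound_cexp_mul {δ h : ℝ} (hθ : 0 < θ) (hδ : 0 < δ) (hh : 1 ≤ h) :
    ∃ h' : ℝ, 1 ≤ h' ∧ ∀ (g : ℂ → ℂ) (M : ℝ), Differentiable ℂ g → LineBound θ h M g → ∀ ξ : ℝ,
      LineBound θ h' (M * Real.exp (δ * |ξ| ^ (1 / θ)))
        ((fun w => Complex.exp (-(Complex.I * ξ) * w)) * g) := by
  obtain ⟨H, hH1, hH⟩ := exists_pow_le_factorial_rpow_mul_exp hθ hδ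
  refine ⟨2 * (H * h), by nlinarith, fun g M hgd hg ξ a b t => ?_⟩
  have hM := hg.nonneg
  set E : ℝ := Real.exp (δ * |ξ| ^ (1 / θ))
  have hterm : ∀ i k, i + k = b →
      |t| ^ a * (‖iteratedDeriv i (fun w : ℂ => Complex.exp (-(Complex.I * ξ) * w)) t‖ *
          ‖iteratedDeriv k g t‖) ≤
        M * E * (H * h) ^ (a + b) * (a ! : ℝ) ^ θ * (b ! : ℝ) ^ θ := by
    rintro i k rfl
    rw [norm_iteratedDeriv_cexp_const_mul, mul_left_comm]
    calc |ξ| ^ i * (|t| ^ a * ‖iteratedDeriv k g t‖)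
        ≤ (H ^ i * (i ! : ℝ) ^ θ * E) * (M * h ^ (a + k) * (a ! : ℝ) ^ θ * (k ! : ℝ) ^ θ) :=
          mul_le_mul (hH i |ξ| (abs_nonneg _)) (hg a k t) (by positivity) (by positivity)
      _ = M * E * (H ^ i * h ^ (a + k)) * (a ! : ℝ) ^ θ * ((i ! : ℝ) ^ θ * (k ! : ℝ) ^ θ) := by
          ring
      _ ≤ _ := by
          have hpow : H ^ i * h ^ (a + k) ≤ (H * h) ^ (a + (i + k)) := by
            rw [mul_pow]
            gcongr <;> first | assumption | omega
          gcongr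
          exact factorial_rpow_mul_le hθ.le i k
  refine (mul_norm_iteratedDeriv_mul_le (by fun_prop) hgd (by positivity) hterm).trans ?_
  calc _ ≤ 2 ^ (a + b) * (M * E * (H * h) ^ (a + b) * (a ! : ℝ) ^ θ * (b ! : ℝ) ^ θ) := by
        gcongr
        · norm_num
        · exact Nat.le_add_left b a
    _ = _ := by
        rw [mul_pow 2]
        ring

theorem exp_smul_kernelOne_eq (x ξ : ℝ) :
    ((Real.exp (-x ^ 2 / 2) : ℝ) : ℂ) • kernelOne (-(ξ : ℂ) - Complex.I * x) =
      (fun w : ℂ => Complex.exp (-(Complex.I * ξ) * w)) * fun w => kernelOne 0 (w - x) := by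
  funext w
  simp only [kernelOne, Pi.smul_apply, Pi.mul_apply, smul_eq_mul]
  push_cast
  rw [← Complex.exp_add, ← Complex.exp_add]
  congr 1
  linear_combination (-(x : ℂ) * w) * Complex.I_mul_I

theorem exists_lineBound_exp_smul_kernelOne {δ : ℝ} (hθ : 1 / 2 ≤ θ) (hδ : 0 < δ) :
    ∃ h : ℝ, 1 ≤ h ∧ ∃ M : ℝ, 0 ≤ M ∧ ∀ x ξ : ℝ,
      LineBound θ h (M * Real.exp (δ * |x| ^ (1 / θ)) * Real.exp (δ * |ξ| ^ (1 / θ)))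
        (((Real.exp (-x ^ 2 / 2) : ℝ) : ℂ) • kernelOne (-(ξ : ℂ) - Complex.I * x)) := by
  have hθ0 : 0 < θ := by linarith
  obtain ⟨h₁, hh₁, hshift⟩ := exists_lineBound_comp_sub_const hθ0 hδ
    (Real.one_le_exp (zero_le_two (α := ℝ)))
  obtain ⟨h₂, hh₂, hmod⟩ := exists_lineBound_cexp_mul hθ0 hδ hh₁
  refine ⟨h₂, hh₂, 2 * Real.exp (3 * ‖(0 : ℂ)‖ ^ 2 + 2), by positivity, fun x ξ => ?_⟩
  rw [exp_smul_kernelOne_eq]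
  exact hmod _ _ ((differentiable_kernelOne 0).comp (differentiable_id.sub_const _))
    (hshift _ _ (lineBound_kernelOne hθ 0) x) ξ

/-! ### Gelfand-Shilov estimates for the Gabor atoms -/

theorem chi_apply (p : Rd d × Rd d) (j : Fin d) :
    chi p j = -(p.2 j : ℂ) - Complex.I * (p.1 j : ℂ) := rfl

theorem continuous_chi : Continuous (chi : Rd d × Rd d → Cd d) := by
  unfold chi
  fun_prop

theorem contDiff_fbiKernel (z : Cd d) : ContDiff ℝ ∞ (fbiKernel z) :=
  (fbiKernel_mem le_rfl z).1

theorem prod_mul_pow_mul_factorial_rpow (M : Fin d → ℝ) (h θ : ℝ) (α β : Fin d → ℕ) :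
    ∏ j, (M j * h ^ (α j + β j) * ((α j)! : ℝ) ^ θ * ((β j)! : ℝ) ^ θ) =
      (∏ j, M j) * h ^ (∑ j, α j + ∑ j, β j) *
        ((∏ j, (α j)! : ℕ) : ℝ) ^ θ * ((∏ j, (β j)! : ℕ) : ℝ) ^ θ := by
  push_cast
  rw [← Real.finsetProd_rpow _ _ fun j _ => by positivity,
    ← Real.finsetProd_rpow _ _ fun j _ => by positivity, ← Finset.sum_add_distrib,
    ← Finset.prod_pow_eq_pow_sum, Finset.prod_mul_distrib, Finset.prod_mul_distrib,
    Finset.prod_mul_distrib]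

theorem GSBound.of_lineBound {h : ℝ} {c : ℂ} {M : Fin d → ℝ} {g : Fin d → ℂ → ℂ} {f : Rd d → ℂ}
    (hf : ∀ β y, multiDeriv β f y = c * ∏ j, iteratedDeriv (β j) (g j) (y j))
    (hg : ∀ j, LineBound θ h (M j) (g j)) : GSBound θ h (‖c‖ * ∏ j, M j) f := by
  intro α β y
  calc ‖((∏ j, y j ^ α j : ℝ) : ℂ) * multiDeriv β f y‖
      = ‖c‖ * ∏ j, (|y j| ^ α j * ‖iteratedDeriv (β j) (g j) (y j)‖) := by
        rw [hf, norm_mul, norm_mul, Complex.norm_real, norm_prod, norm_prod,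
          Finset.prod_mul_distrib]
        simp only [norm_pow, Real.norm_eq_abs]
        ring
    _ ≤ ‖c‖ * ∏ j, (M j * h ^ (α j + β j) * ((α j)! : ℝ) ^ θ * ((β j)! : ℝ) ^ θ) := by
        refine mul_le_mul_of_nonneg_left ?_ (norm_nonneg c)
        exact Finset.prod_le_prod (fun j _ => by positivity) fun j _ => hg j (α j) (β j) (y j)
    _ = _ := by
        rw [prod_mul_pow_mul_factorial_rpow]
        ring

theorem multiDeriv_gaborAtom (p : Rd d × Rd d) (β : Fin d → ℕ) (y : Rd d) :
    multiDeriv β (gaborAtom p) y = ((Real.pi ^ (-(d : ℝ) / 4) : ℝ) : ℂ) *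
      ∏ j, iteratedDeriv (β j) (((Real.exp (-(p.1 j) ^ 2 / 2) : ℝ) : ℂ) • kernelOne (chi p j))
        (y j) := by
  have hgauss : Real.exp (-‖p.1‖ ^ 2 / 2) = ∏ j, Real.exp (-(p.1 j) ^ 2 / 2) := by
    rw [← Real.exp_sum, EuclideanSpace.real_norm_sq_eq, neg_div, Finset.sum_div,
      ← Finset.sum_neg_distrib]
    simp only [neg_div]
  have hkernel := contDiff_fbiKernel (chi p)
  simp only [iteratedDeriv_const_smul_field, Finset.prod_mul_distrib, smul_eq_mul]
  rw [gaborAtom_eq, (multiDeriv_linear β hkernel hkernel _).2,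
    Pi.smul_apply, smul_eq_mul, multiDeriv_fbiKernel, hgauss]
  push_cast
  ring

theorem exists_GSBound_gaborAtom (d : ℕ) {δ : ℝ} (hθ : 1 / 2 ≤ θ) (hδ : 0 < δ) :
    ∃ h : ℝ, 0 < h ∧ ∃ M : ℝ, ∀ p : Rd d × Rd d,
      GSBound θ h (M * Real.exp (δ * ‖p‖ ^ (1 / θ))) (gaborAtom p) := by
  obtain ⟨h, hh, M, hM, hline⟩ :=
    exists_lineBound_exp_smul_kernelOne hθ (δ := δ / (2 * d + 1)) (by positivity)
  refine ⟨h, by linarith, Real.pi ^ (-(d : ℝ) / 4) * M ^ d, fun p => ?_⟩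
  have hatom := GSBound.of_lineBound (multiDeriv_gaborAtom p) fun j =>
    (hline (p.1 j) (p.2 j)).mono (M' := M * Real.exp (δ / (2 * d + 1) * ‖p‖ ^ (1 / θ)) *
      Real.exp (δ / (2 * d + 1) * ‖p‖ ^ (1 / θ))) le_rfl (by linarith) (by
        gcongr
        · exact (PiLp.norm_apply_le p.1 j).trans (norm_fst_le p)
        · exact (PiLp.norm_apply_le p.2 j).trans (norm_snd_le p))
  refine fun α β y => (hatom α β y).trans ?_
  gcongr ?_ * _ * _ * _
  rw [Complex.norm_real, Real.norm_of_nonneg (by positivity), Finset.prod_const,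
    Finset.card_univ, Fintype.card_fin, mul_assoc M, ← Real.exp_add, mul_pow,
    ← Real.exp_nat_mul, ← mul_assoc]
  gcongr _ * Real.exp ?_
  have hexponent : (d : ℝ) * (δ / (2 * d + 1) * ‖p‖ ^ (1 / θ) + δ / (2 * d + 1) * ‖p‖ ^ (1 / θ)) =
      2 * d / (2 * d + 1) * (δ * ‖p‖ ^ (1 / θ)) := by
    field_simp
    ring
  rw [hexponent]
  exact mul_le_of_le_one_left (by positivity) (div_le_one_of_le₀ (by linarith) (by positivity))

theorem exists_norm_stftDual_le (hθ : 1 / 2 ≤ θ) (u : GSDual θ d) {δ : ℝ} (hδ : 0 < δ) :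
    ∃ C : ℝ, ∀ p, ‖stftDual hθ u p‖ ≤ C * Real.exp (δ * ‖p‖ ^ (1 / θ)) := by
  obtain ⟨h, hh, M, hatom⟩ := exists_GSBound_gaborAtom d hθ hδ
  obtain ⟨K, hK⟩ := u.2 h hh
  refine ⟨(2 * Real.pi) ^ (-(d : ℝ) / 2) * (K * M), fun p => ?_⟩
  rw [stftDual, norm_mul, Complex.norm_real, Real.norm_of_nonneg (by positivity), mul_assoc]
  gcongr
  refine (hK ⟨gaborAtom p, gaborAtom_mem hθ p⟩ _ (hatom p)).trans_eq ?_
  ring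

theorem norm_prod_sub_prod_le {ι R : Type*} [NormedCommRing R] [NormOneClass R]
    (s : Finset ι) {a b : ι → R} {c : ι → ℝ} {δ : ℝ} (ha : ∀ i, ‖a i‖ ≤ c i)
    (hb : ∀ i, ‖b i‖ ≤ c i) (hab : ∀ i, ‖a i - b i‖ ≤ δ * c i) :
    ‖∏ i ∈ s, a i - ∏ i ∈ s, b i‖ ≤ s.card * δ * ∏ i ∈ s, c i := by
  classical
  have hc : ∀ i, 0 ≤ c i := fun i => (norm_nonneg _).trans (ha i)
  induction s using Finset.induction_on with
  | empty => simp
  | insert j s hj ih =>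
    rw [Finset.prod_insert hj, Finset.prod_insert hj, Finset.prod_insert hj,
      Finset.card_insert_of_notMem hj]
    have hprod : ‖∏ i ∈ s, a i‖ ≤ ∏ i ∈ s, c i :=
      (Finset.norm_prod_le s a).trans
        (Finset.prod_le_prod (fun _ _ => norm_nonneg _) fun i _ => ha i)
    calc ‖a j * ∏ i ∈ s, a i - b j * ∏ i ∈ s, b i‖
        = ‖(a j - b j) * ∏ i ∈ s, a i + b j * (∏ i ∈ s, a i - ∏ i ∈ s, b i)‖ := by ring_nf
      _ ≤ ‖a j - b j‖ * ‖∏ i ∈ s, a i‖ + ‖b j‖ * ‖∏ i ∈ s, a i - ∏ i ∈ s, b i‖ :=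
          (norm_add_le _ _).trans (add_le_add (norm_mul_le _ _) (norm_mul_le _ _))
      _ ≤ δ * c j * ∏ i ∈ s, c i + c j * (s.card * δ * ∏ i ∈ s, c i) :=
          add_le_add
            (mul_le_mul (hab j) hprod (norm_nonneg _) ((norm_nonneg _).trans (hab j)))
            (mul_le_mul (hb j) ih (norm_nonneg _) (hc j))
      _ = _ := by
          push_cast
          ring

theorem multiDeriv_fbiKernel_sub (z z' : Cd d) (β : Fin d → ℕ) (y : Rd d) :
    multiDeriv β (fbiKernel z - fbiKernel z') y =
      ∏ j, iteratedDeriv (β j) (kernelOne (z j)) (y j) -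
        ∏ j, iteratedDeriv (β j) (kernelOne (z' j)) (y j) := by
  have hz := contDiff_fbiKernel z
  have hz' := contDiff_fbiKernel z'
  have hneg : ContDiff ℝ ∞ ((-1 : ℂ) • fbiKernel z') := hz'.const_smul (-1 : ℂ)
  rw [sub_eq_add_neg, ← neg_one_smul ℂ (fbiKernel z'),
    (multiDeriv_linear β hz hneg 0).1, (multiDeriv_linear β hz' hz' (-1)).2,
    Pi.add_apply, Pi.smul_apply, multiDeriv_fbiKernel, multiDeriv_fbiKernel, smul_eq_mul]
  ring

theorem exists_GSBound_fbiKernel_sub (d : ℕ) (hθ : 1 / 2 ≤ θ) (R : ℝ) :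
    ∃ h : ℝ, 0 < h ∧ ∃ M : ℝ, ∀ z z' : Cd d, ‖z‖ ≤ R → ‖z'‖ ≤ R →
      GSBound θ h (M * ‖z - z'‖) (fbiKernel z - fbiKernel z') := by
  obtain ⟨h₀, hh₀, M₀, hM₀, hdiff⟩ := exists_lineBound_kernelOne_sub hθ R
  set h := max h₀ (Real.exp 2)
  set M := max M₀ (Real.exp (3 * R ^ 2 + 2))
  have hh : 0 < h := lt_max_of_lt_right (Real.exp_pos _)
  refine ⟨h, hh, d * M ^ d, fun z z' hz hz' α β y => ?_⟩
  have hval : ∀ w : Cd d, ‖w‖ ≤ R → ∀ j, ‖((y j ^ α j : ℝ) : ℂ) *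
      iteratedDeriv (β j) (kernelOne (w j)) (y j)‖ ≤
        M * h ^ (α j + β j) * ((α j)! : ℝ) ^ θ * ((β j)! : ℝ) ^ θ := by
    intro w hw j
    rw [norm_mul, Complex.norm_real, norm_pow, Real.norm_eq_abs]
    refine (lineBound_kernelOne hθ (w j) (α j) (β j) (y j)).trans ?_
    have hwj : ‖w j‖ ≤ R := (PiLp.norm_apply_le w j).trans hw
    gcongr
    · exact le_max_of_le_right (by gcongr)
    · exact le_max_right _ _
  have hprod := norm_prod_sub_prod_le Finset.univ (δ := ‖z - z'‖) (hval z hz) (hval z' hz')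
    fun j => by
      rw [← mul_sub, norm_mul, Complex.norm_real, norm_pow, Real.norm_eq_abs]
      have hsub := hdiff (z j) (z' j) ((PiLp.norm_apply_le z j).trans hz)
        ((PiLp.norm_apply_le z' j).trans hz') (α j) (β j) (y j)
      rw [iteratedDeriv_sub ((contDiff_kernelOne _).contDiffAt.of_le le_top)
        ((contDiff_kernelOne _).contDiffAt.of_le le_top)] at hsub
      refine hsub.trans ?_
      rw [mul_assoc ‖_‖, mul_assoc ‖_‖, mul_assoc ‖_‖]
      gcongr
      · exact PiLp.norm_apply_le (z - z') j
      · exact le_max_left _ _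
      · exact le_max_left _ _
  rw [multiDeriv_fbiKernel_sub, mul_sub, Complex.ofReal_prod, ← Finset.prod_mul_distrib,
    ← Finset.prod_mul_distrib]
  refine hprod.trans_eq ?_
  rw [prod_mul_pow_mul_factorial_rpow, Finset.prod_const, Finset.card_univ, Fintype.card_fin]
  ring

theorem continuous_apply_fbiKernel (hθ : 1 / 2 ≤ θ) (u : GSDual θ d) :
    Continuous fun z : Cd d => u.1 ⟨fbiKernel z, fbiKernel_mem hθ z⟩ := by
  refine continuous_iff_continuousAt.mpr fun z₀ => ?_
  obtain ⟨h, hh, M, hM⟩ := exists_GSBound_fbiKernel_sub d hθ (‖z₀‖ + 1)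
  obtain ⟨K, hK⟩ := u.2 h hh
  refine tendsto_iff_norm_sub_tendsto_zero.mpr ?_
  have hlim : Filter.Tendsto (fun z : Cd d => K * (M * ‖z - z₀‖)) (nhds z₀) (nhds 0) := by
    have : Continuous fun z : Cd d => K * (M * ‖z - z₀‖) := by fun_prop
    simpa using this.tendsto z₀
  refine squeeze_zero' (Filter.Eventually.of_forall fun _ => norm_nonneg _) ?_ hlim
  filter_upwards [Metric.ball_mem_nhds z₀ one_pos] with z hz
  rw [Metric.mem_ball, dist_eq_norm] at hz
  rw [← map_sub]
  exact hK _ _ (hM z z₀ (by linarith [norm_sub_norm_le z z₀]) (by linarith))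

theorem stftDual_eq (hθ : 1 / 2 ≤ θ) (u : GSDual θ d) (p : Rd d × Rd d) :
    stftDual hθ u p = (((2 * Real.pi) ^ (-(d : ℝ) / 2) : ℝ) : ℂ) *
      ((((Real.pi ^ (-(d : ℝ) / 4) * Real.exp (-‖p.1‖ ^ 2 / 2) : ℝ)) : ℂ) *
        u.1 ⟨fbiKernel (chi p), fbiKernel_mem hθ (chi p)⟩) := by
  have hatom : (⟨gaborAtom p, gaborAtom_mem hθ p⟩ : GS θ d) =
      (((Real.pi ^ (-(d : ℝ) / 4) * Real.exp (-‖p.1‖ ^ 2 / 2) : ℝ)) : ℂ) •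
        ⟨fbiKernel (chi p), fbiKernel_mem hθ (chi p)⟩ := Subtype.ext (gaborAtom_eq p)
  rw [stftDual, hatom, map_smul, smul_eq_mul]

theorem continuous_stftDual (hθ : 1 / 2 ≤ θ) (u : GSDual θ d) : Continuous (stftDual hθ u) := by
  have hkernel := (continuous_apply_fbiKernel hθ u).comp continuous_chi
  simp only [funext (stftDual_eq hθ u)]
  fun_prop

/-! ### Decay of the short-time Fourier transform of a Gelfand-Shilov function -/

theorem prod_apply_pi_single {ι M : Type*} [Fintype ι] [DecidableEq ι] [CommMonoid M]
    {F : ι → ℕ → M} (hF : ∀ i, F i 0 = 1) (j : ι) (n : ℕ) :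
    ∏ i, F i ((Pi.single j n : ι → ℕ) i) = F j n := by
  rw [Fintype.prod_eq_single j fun i hi => by rw [Pi.single_eq_of_ne hi, hF], Pi.single_eq_same]

theorem multiDeriv_zero (f : Rd d → ℂ) : multiDeriv 0 f = f := by
  simp [multiDeriv]

theorem multiDeriv_single (j : Fin d) (k : ℕ) (f : Rd d → ℂ) :
    multiDeriv (Pi.single j k) f = (partialDeriv j)^[k] f := by
  have hfold : ∀ l : List (Fin d), l.Nodup →
      l.foldr (fun i g => (partialDeriv i)^[(Pi.single j k : Fin d → ℕ) i] g) f =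
        if j ∈ l then (partialDeriv j)^[k] f else f := by
    intro l hl
    induction l with
    | nil => simp
    | cons i l ih =>
      rw [List.nodup_cons] at hl
      rw [List.foldr_cons, ih hl.2]
      by_cases hij : i = j
      · subst hij
        simp [hl.1]
      · simp [hij, Ne.symm hij]
  simpa [multiDeriv] using hfold _ (List.nodup_finRange d)

namespace GSBound

variable {h M : ℝ} {f : Rd d → ℂ}

theorem norm_iterate_partialDeriv_le (hf : GSBound θ h M f) (j : Fin d) (k : ℕ) (y : Rd d) :
    ‖(partialDeriv j)^[k] f y‖ ≤ M * h ^ k * (k ! : ℝ) ^ θ := by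
  simpa [multiDeriv_single, prod_apply_pi_single (F := fun _ n => (n ! : ℝ))] using
    hf 0 (Pi.single j k) y

theorem abs_apply_pow_mul_norm_le (hf : GSBound θ h M f) (j : Fin d) (n : ℕ) (y : Rd d) :
    |y j| ^ n * ‖f y‖ ≤ M * h ^ n * (n ! : ℝ) ^ θ := by
  simpa [multiDeriv_zero, prod_apply_pi_single (F := fun _ n => (n ! : ℝ)),
    prod_apply_pi_single (F := fun i n => (y i : ℂ) ^ n)] using hf (Pi.single j n) 0 y

theorem norm_le (hf : GSBound θ h M f) (y : Rd d) : ‖f y‖ ≤ M := by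
  simpa [multiDeriv_zero] using hf 0 0 y

end GSBound

theorem exists_norm_le_exp_neg_of_GSBound (d : ℕ) {h : ℝ} (hθ : 0 < θ) (hh : 0 < h) :
    ∃ ε > 0, ∃ K : ℝ, 0 ≤ K ∧ ∀ (f : Rd d → ℂ) (M : ℝ), GSBound θ h M f →
      ∀ y, ‖f y‖ ≤ K * M * Real.exp (-ε * ‖y‖ ^ (1 / θ)) := by
  obtain ⟨ε, hε, K, hK, hdecay⟩ := exists_le_exp_neg_norm_of_forall_coord d hθ hh
  exact ⟨ε, hε, K, hK, fun f M hf y =>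
    hdecay y _ M (norm_nonneg _) (hf.norm_le y) fun j n => hf.abs_apply_pow_mul_norm_le j n y⟩

theorem norm_exp_neg_I_mul_ofReal (t : ℝ) : ‖Complex.exp (-(Complex.I * t))‖ = 1 := by
  simp [Complex.norm_exp]

theorem norm_gaborAtom (p : Rd d × Rd d) (y : Rd d) :
    ‖gaborAtom p y‖ = Real.pi ^ (-(d : ℝ) / 4) * Real.exp (-(1 / 2) * ‖y - p.1‖ ^ 2) := by
  rw [gaborAtom, norm_mul, norm_exp_neg_I_mul_ofReal, mul_one, Complex.norm_real, gaussWindow,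
    Real.norm_of_nonneg (by positivity)]
  congr 2
  ring

theorem exists_norm_stftFun_le_exp_position (d : ℕ) {h : ℝ} (hθ : 1 / 2 ≤ θ) (hh : 0 < h) :
    ∃ ε > 0, ∃ K : ℝ, 0 ≤ K ∧ ∀ (f : Rd d → ℂ) (M : ℝ), GSBound θ h M f →
      ∀ p, ‖stftFun f p‖ ≤ K * M * Real.exp (-ε * ‖p.1‖ ^ (1 / θ)) := by
  obtain ⟨ε₀, hε₀, K, hK, hdecay⟩ := exists_norm_le_exp_neg_of_GSBound d (by linarith : 0 < θ) hh
  set ε := min ε₀ (1 / 4)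
  have hε : 0 < ε := lt_min hε₀ (by norm_num)
  have hε4 : ε ≤ 1 / 4 := min_le_right _ _
  set J := ∫ y : Rd d, Real.exp (-(1 / 4) * ‖y‖ ^ 2)
  refine ⟨ε / 4, by positivity, (2 * Real.pi) ^ (-(d : ℝ) / 2) *
    (Real.pi ^ (-(d : ℝ) / 4) * K * Real.exp ε * J), by positivity, fun f M hf p => ?_⟩
  have hM := hf.nonneg
  have hpoint : ∀ y, ‖f y * gaborAtom p y‖ ≤ Real.pi ^ (-(d : ℝ) / 4) * K * M *
      (Real.exp ε * Real.exp (-(ε / 4) * ‖p.1‖ ^ (1 / θ))) *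
        Real.exp (-(1 / 4) * ‖y - p.1‖ ^ 2) := by
    intro y
    have hsub := norm_rpow_one_div_le_of_sub hθ p.1 y
    rw [norm_sub_rev] at hsub
    calc ‖f y * gaborAtom p y‖
        ≤ K * M * Real.exp (-ε * ‖y‖ ^ (1 / θ)) *
          (Real.pi ^ (-(d : ℝ) / 4) * Real.exp (-(1 / 2) * ‖y - p.1‖ ^ 2)) := by
          rw [norm_mul, norm_gaborAtom]
          gcongr
          refine (hdecay f M hf y).trans ?_
          gcongr
          exact min_le_left _ _
      _ = Real.pi ^ (-(d : ℝ) / 4) * K * M *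
          Real.exp (-ε * ‖y‖ ^ (1 / θ) + -(1 / 2) * ‖y - p.1‖ ^ 2) := by
          rw [Real.exp_add]
          ring
      _ ≤ _ := by
          rw [← Real.exp_add, mul_assoc _ (Real.exp _), ← Real.exp_add]
          refine mul_le_mul_of_nonneg_left (Real.exp_le_exp.mpr ?_) (by positivity)
          nlinarith [mul_le_mul_of_nonneg_left hsub hε.le,
            mul_le_mul_of_nonneg_right hε4 (sq_nonneg ‖y - p.1‖)]
  rw [stftFun, norm_mul, Complex.norm_real, Real.norm_of_nonneg (by positivity)]
  refine (mul_le_mul_of_nonneg_left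
    (norm_integral_le_of_norm_le_gaussian (by norm_num) p.1 hpoint) (by positivity)).trans_eq ?_
  ring

/-- The Gaussian `e^{-|y|²/2}` differentiated along the multi-index `n`, translated by `x` and
modulated by `e^{-i⟨ξ,y⟩}`, with `p = (x,ξ)`. Since the modulation is not differentiated, its size
does not depend on `ξ`. -/
noncomputable def gaborDeriv (n : Fin d → ℕ) (p : Rd d × Rd d) (y : Rd d) : ℂ :=
  (∏ i, iteratedDeriv (n i) (kernelOne ((0 : Cd d) i)) ((y - p.1) i : ℂ)) *
    Complex.exp (-(Complex.I * (inner ℝ p.2 y : ℝ)))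

theorem gaborAtom_eq_gaborDeriv (p : Rd d × Rd d) (y : Rd d) :
    gaborAtom p y = ((Real.pi ^ (-(d : ℝ) / 4) : ℝ) : ℂ) * gaborDeriv 0 p y := by
  have hgauss : ∏ i, kernelOne ((0 : Cd d) i) ((y - p.1) i : ℂ) =
      ((Real.exp (-‖y - p.1‖ ^ 2 / 2) : ℝ) : ℂ) := by
    rw [← fbiKernel_eq_prod, fbiKernel, Complex.ofReal_exp]
    simp only [PiLp.zero_apply, zero_mul, Finset.sum_const_zero, zero_add]
    congr 1
    push_cast
    linear_combination (‖y - p.1‖ ^ 2 / 2 : ℂ) * Complex.I_mul_I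
  simp only [gaborDeriv, Pi.zero_apply, iteratedDeriv_zero]
  rw [hgauss, gaborAtom, gaussWindow]
  push_cast
  ring

theorem contDiff_gaborDeriv (n : Fin d → ℕ) (p : Rd d × Rd d) :
    ContDiff ℝ ∞ (gaborDeriv n p) := by
  have hshift := (contDiff_kernel_prod (0 : Cd d) n).comp
    (contDiff_id.sub (contDiff_const (c := p.1)))
  have hinner : ContDiff ℝ ∞ fun y : Rd d => ((inner ℝ p.2 y : ℝ) : ℂ) :=
    Complex.ofRealCLM.contDiff.comp (innerSL ℝ p.2).contDiff
  exact hshift.mul (contDiff_const.mul hinner).neg.cexp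

theorem hasFDerivAt_cexp_neg_I_mul_inner (ξ y : Rd d) :
    HasFDerivAt (fun y => Complex.exp (-(Complex.I * (inner ℝ ξ y : ℝ))))
      (Complex.exp (-(Complex.I * (inner ℝ ξ y : ℝ))) •
        -(Complex.I • Complex.ofRealCLM.comp (innerSL ℝ ξ))) y :=
  ((Complex.ofRealCLM.comp (innerSL ℝ ξ)).hasFDerivAt.const_mul Complex.I).neg.cexp

theorem partialDeriv_gaborDeriv (n : Fin d → ℕ) (p : Rd d × Rd d) (j : Fin d) (y : Rd d) :
    partialDeriv j (gaborDeriv n p) y =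
      gaborDeriv (Function.update n j (n j + 1)) p y -
        Complex.I * (p.2 j : ℂ) * gaborDeriv n p y := by
  have hprod := congrFun (partialDeriv_prod (0 : Cd d) n j) (y - p.1)
  set G : Rd d → ℂ := fun y => ∏ i, iteratedDeriv (n i) (kernelOne ((0 : Cd d) i)) (y i : ℂ)
  have hG : HasFDerivAt (fun y => G (y - p.1)) (fderiv ℝ G (y - p.1)) y := by
    rw [← fderiv_comp_sub p.1]
    have hsmooth : ContDiff ℝ ∞ fun y => G (y - p.1) :=
      (contDiff_kernel_prod (0 : Cd d) n).comp (contDiff_id.sub contDiff_const)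
    exact (hsmooth.differentiable (by simp) y).hasFDerivAt
  have hderiv := (hG.mul (hasFDerivAt_cexp_neg_I_mul_inner p.2 y)).fderiv
  simp only [partialDeriv] at hprod ⊢
  refine (congrArg (fun L => L (EuclideanSpace.single j 1)) hderiv).trans ?_
  simp only [add_apply, smul_apply, neg_apply, ContinuousLinearMap.comp_apply, innerSL_apply_apply,
    Complex.ofRealCLM_apply, smul_eq_mul]
  rw [hprod, EuclideanSpace.inner_single_right]
  simp only [gaborDeriv, conj_trivial, one_mul, G]
  ring

theorem norm_gaborDeriv_le (n : Fin d → ℕ) (p : Rd d × Rd d) (y : Rd d) :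
    ‖gaborDeriv n p y‖ ≤ Real.exp (-(1 / 8) * ‖y - p.1‖ ^ 2) *
      Real.exp 3 ^ (∑ i, n i + d) * ∏ i, √((n i)! : ℝ) := by
  rw [gaborDeriv, norm_mul, norm_exp_neg_I_mul_ofReal, mul_one, norm_prod]
  calc ∏ i, ‖iteratedDeriv (n i) (kernelOne ((0 : Cd d) i)) ((y - p.1) i : ℂ)‖
      ≤ ∏ i, (Real.exp (-(1 / 8) * (y - p.1) i ^ 2) * Real.exp 3 ^ (n i + 1) *
          √((n i)! : ℝ)) :=
        Finset.prod_le_prod (fun _ _ => norm_nonneg _)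
          fun i _ => norm_iteratedDeriv_kernelOne_zero_le _ _
    _ = _ := by
        rw [Finset.prod_mul_distrib, Finset.prod_mul_distrib, ← Real.exp_sum, ← Finset.mul_sum,
          ← EuclideanSpace.real_norm_sq_eq, Finset.prod_pow_eq_pow_sum, Finset.sum_add_distrib,
          Finset.sum_const, Finset.card_univ, Fintype.card_fin, smul_eq_mul, mul_one]

theorem norm_pow_mul_le_of_recurrence {R : Type*} [NormedDivisionRing R] {W : ℕ → ℕ → R} {c : R}
    {A B θ : ℝ} (hrec : ∀ k l, c * W k l = W (k + 1) l + W k (l + 1))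
    (hW : ∀ k l, ‖W k l‖ ≤ B * A ^ (k + l) * ((k + l)! : ℝ) ^ θ) (n k l : ℕ) :
    ‖c‖ ^ n * ‖W k l‖ ≤ B * 2 ^ n * A ^ (k + l + n) * ((k + l + n)! : ℝ) ^ θ := by
  induction n generalizing k l with
  | zero => simpa using hW k l
  | succ n ih =>
    have hstep : ‖c‖ * ‖W k l‖ ≤ ‖W (k + 1) l‖ + ‖W k (l + 1)‖ := by
      rw [← norm_mul, hrec]
      exact norm_add_le _ _
    have hleft := ih (k + 1) l
    have hright := ih k (l + 1)
    rw [show k + 1 + l + n = k + l + (n + 1) by ring] at hleft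
    rw [show k + (l + 1) + n = k + l + (n + 1) by ring] at hright
    calc ‖c‖ ^ (n + 1) * ‖W k l‖ = ‖c‖ ^ n * (‖c‖ * ‖W k l‖) := by ring
      _ ≤ ‖c‖ ^ n * (‖W (k + 1) l‖ + ‖W k (l + 1)‖) := by gcongr
      _ = ‖c‖ ^ n * ‖W (k + 1) l‖ + ‖c‖ ^ n * ‖W k (l + 1)‖ := by ring
      _ ≤ _ := add_le_add hleft hright
      _ = _ := by ring

section IntegrationByParts

variable {h M : ℝ} {f : Rd d → ℂ}

theorem norm_iterate_partialDeriv_mul_gaborDeriv_le (hθ : 1 / 2 ≤ θ) (hh : 0 < h)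
    (hb : GSBound θ h M f) (p : Rd d × Rd d) (j : Fin d) (k l : ℕ) (y : Rd d) :
    ‖(partialDeriv j)^[k] f y * gaborDeriv (Pi.single j l) p y‖ ≤
      M * Real.exp 3 ^ d * (max h (Real.exp 3)) ^ (k + l) * ((k + l)! : ℝ) ^ θ *
        Real.exp (-(1 / 8) * ‖y - p.1‖ ^ 2) := by
  have hM := hb.nonneg
  have hatom := norm_gaborDeriv_le (Pi.single j l) p y
  rw [prod_apply_pi_single (F := fun _ n => √(n ! : ℝ)) (by simp), Finset.sum_pi_single',
    if_pos (Finset.mem_univ j)] at hatom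
  have hsqrt : √(l ! : ℝ) ≤ (l ! : ℝ) ^ θ := by
    rw [Real.sqrt_eq_rpow]
    exact Real.rpow_le_rpow_of_exponent_le (by exact_mod_cast l.factorial_pos) hθ
  rw [norm_mul]
  calc ‖(partialDeriv j)^[k] f y‖ * ‖gaborDeriv (Pi.single j l) p y‖
      ≤ (M * h ^ k * (k ! : ℝ) ^ θ) * (Real.exp (-(1 / 8) * ‖y - p.1‖ ^ 2) *
          Real.exp 3 ^ (l + d) * √(l ! : ℝ)) :=
        mul_le_mul (hb.norm_iterate_partialDeriv_le j k y) hatom (norm_nonneg _) (by positivity)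
    _ ≤ (M * max h (Real.exp 3) ^ k * (k ! : ℝ) ^ θ) * (Real.exp (-(1 / 8) * ‖y - p.1‖ ^ 2) *
          (max h (Real.exp 3) ^ l * Real.exp 3 ^ d) * (l ! : ℝ) ^ θ) := by
        rw [pow_add]
        gcongr
        exacts [le_max_left _ _, le_max_right _ _]
    _ = M * Real.exp 3 ^ d * max h (Real.exp 3) ^ (k + l) * ((k ! : ℝ) ^ θ * (l ! : ℝ) ^ θ) *
          Real.exp (-(1 / 8) * ‖y - p.1‖ ^ 2) := by ring
    _ ≤ _ := by
        gcongr
        exact factorial_rpow_mul_le (by linarith) k l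

theorem integrable_iterate_partialDeriv_mul_gaborDeriv (hθ : 1 / 2 ≤ θ) (hf : ContDiff ℝ ∞ f)
    (hh : 0 < h) (hb : GSBound θ h M f) (p : Rd d × Rd d) (j : Fin d) (k l : ℕ) :
    Integrable fun y => (partialDeriv j)^[k] f y * gaborDeriv (Pi.single j l) p y :=
  ((integrable_exp_neg_mul_norm_sub_sq (by norm_num) p.1).const_mul _).mono'
    ((contDiff_iterate_partialDeriv j k hf).continuous.mul
      (contDiff_gaborDeriv _ p).continuous).aestronglyMeasurable
    (Filter.Eventually.of_forall
      (norm_iterate_partialDeriv_mul_gaborDeriv_le hθ hh hb p j k l))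

theorem frequency_mul_integral_gaborDeriv (hθ : 1 / 2 ≤ θ) (hf : ContDiff ℝ ∞ f) (hh : 0 < h)
    (hb : GSBound θ h M f) (p : Rd d × Rd d) (j : Fin d) (k l : ℕ) :
    Complex.I * (p.2 j : ℂ) * ∫ y, (partialDeriv j)^[k] f y * gaborDeriv (Pi.single j l) p y =
      (∫ y, (partialDeriv j)^[k + 1] f y * gaborDeriv (Pi.single j l) p y) +
        ∫ y, (partialDeriv j)^[k] f y * gaborDeriv (Pi.single j (l + 1)) p y := by
  have hint := integrable_iterate_partialDeriv_mul_gaborDeriv hθ hf hh hb p j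
  have hprod : ∀ y, (partialDeriv j)^[k] f y *
      fderiv ℝ (gaborDeriv (Pi.single j l) p) y (EuclideanSpace.single j 1) =
      (partialDeriv j)^[k] f y * gaborDeriv (Pi.single j (l + 1)) p y -
        Complex.I * (p.2 j : ℂ) *
          ((partialDeriv j)^[k] f y * gaborDeriv (Pi.single j l) p y) := fun y => by
    have hderiv := partialDeriv_gaborDeriv (Pi.single j l) p j y
    rw [Pi.single_eq_same, Pi.single, Function.update_idem, partialDeriv] at hderiv
    rw [Pi.single, hderiv]
    simp only [Pi.single]
    ring
  have hsucc : ∀ y, fderiv ℝ ((partialDeriv j)^[k] f) y (EuclideanSpace.single j 1) =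
      (partialDeriv j)^[k + 1] f y := fun y => by
    rw [Function.iterate_succ_apply']
    rfl
  have hparts := integral_mul_fderiv_eq_neg_fderiv_mul_of_integrable
    (μ := (volume : Measure (Rd d))) (f := (partialDeriv j)^[k] f)
    (g := gaborDeriv (Pi.single j l) p) (v := EuclideanSpace.single j 1)
    (by simpa only [hsucc] using hint (k + 1) l)
    (by
      simp only [hprod]
      exact (hint k (l + 1)).sub ((hint k l).const_mul _))
    (hint k l)
    (fun x _ => (contDiff_iterate_partialDeriv j k hf).differentiable (by simp) x)
    (fun x _ => (contDiff_gaborDeriv _ p).differentiable (by simp) x)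
  simp only [hprod, hsucc] at hparts
  rw [integral_sub (hint k (l + 1)) ((hint k l).const_mul _), integral_const_mul] at hparts
  linear_combination -hparts

theorem norm_stftFun_eq (f : Rd d → ℂ) (p : Rd d × Rd d) :
    ‖stftFun f p‖ = (2 * Real.pi) ^ (-(d : ℝ) / 2) * Real.pi ^ (-(d : ℝ) / 4) *
      ‖∫ y, f y * gaborDeriv 0 p y‖ := by
  simp only [stftFun, gaborAtom_eq_gaborDeriv, mul_left_comm (f _)]
  rw [integral_const_mul, norm_mul, norm_mul, Complex.norm_real, Complex.norm_real,
    Real.norm_of_nonneg (by positivity), Real.norm_of_nonneg (by positivity), mul_assoc]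

end IntegrationByParts

theorem exists_abs_frequency_pow_mul_norm_stftFun_le (d : ℕ) {h : ℝ} (hθ : 1 / 2 ≤ θ)
    (hh : 0 < h) : ∃ A > 0, ∃ K : ℝ, 0 ≤ K ∧ ∀ (f : Rd d → ℂ) (M : ℝ), ContDiff ℝ ∞ f →
      GSBound θ h M f → ∀ (p : Rd d × Rd d) (j : Fin d) (n : ℕ),
        |p.2 j| ^ n * ‖stftFun f p‖ ≤ K * M * A ^ n * (n ! : ℝ) ^ θ := by
  set J := ∫ y : Rd d, Real.exp (-(1 / 8) * ‖y‖ ^ 2)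
  set c := (2 * Real.pi) ^ (-(d : ℝ) / 2) * Real.pi ^ (-(d : ℝ) / 4)
  refine ⟨2 * max h (Real.exp 3), by positivity, c * (Real.exp 3 ^ d * J), by positivity,
    fun f M hf hb p j n => ?_⟩
  have hmoment := norm_pow_mul_le_of_recurrence (A := max h (Real.exp 3))
    (B := M * Real.exp 3 ^ d * J) (θ := θ)
    (frequency_mul_integral_gaborDeriv hθ hf hh hb p j)
    (fun k l => by
      refine (norm_integral_le_of_norm_le_gaussian (by norm_num) p.1
        (norm_iterate_partialDeriv_mul_gaborDeriv_le hθ hh hb p j k l)).trans_eq ?_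
      ring) n 0 0
  simp only [norm_mul, Complex.norm_I, one_mul, Complex.norm_real, Real.norm_eq_abs,
    Function.iterate_zero, id_eq, Pi.single_zero, zero_add] at hmoment
  rw [norm_stftFun_eq]
  calc |p.2 j| ^ n * (c * ‖∫ y, f y * gaborDeriv 0 p y‖)
      = c * (|p.2 j| ^ n * ‖∫ y, f y * gaborDeriv 0 p y‖) := by ring
    _ ≤ c * (M * Real.exp 3 ^ d * J * 2 ^ n * max h (Real.exp 3) ^ n * (n ! : ℝ) ^ θ) := by
        exact mul_le_mul_of_nonneg_left hmoment (by positivity)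
    _ = _ := by
        rw [mul_pow]
        ring

theorem exists_norm_stftFun_le (d : ℕ) {h : ℝ} (hθ : 1 / 2 ≤ θ) (hh : 0 < h) :
    ∃ ε > 0, ∃ K : ℝ, ∀ (f : Rd d → ℂ) (M : ℝ), ContDiff ℝ ∞ f → GSBound θ h M f →
      ∀ p, ‖stftFun f p‖ ≤ K * M * Real.exp (-ε * ‖p‖ ^ (1 / θ)) := by
  have hθ0 : 0 < θ := by linarith
  obtain ⟨ε₁, hε₁, K₁, hK₁, hposition⟩ := exists_norm_stftFun_le_exp_position d hθ hh
  obtain ⟨A, hA, K₂, hK₂, hfrequency⟩ := exists_abs_frequency_pow_mul_norm_stftFun_le d hθ hh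
  obtain ⟨ε₂, hε₂, K₃, hK₃, hdecay⟩ := exists_le_exp_neg_norm_of_forall_coord d hθ0 hA
  refine ⟨min ε₁ ε₂, lt_min hε₁ hε₂, K₁ + K₃ * (K₁ + K₂), fun f M hf hb p => ?_⟩
  have hM := hb.nonneg
  have hbound : ‖stftFun f p‖ ≤ (K₁ + K₂) * M :=
    calc ‖stftFun f p‖ ≤ K₁ * M * Real.exp (-ε₁ * ‖p.1‖ ^ (1 / θ)) := hposition f M hb p
      _ ≤ K₁ * M := mul_le_of_le_one_right (by positivity)
          (Real.exp_le_one_iff.mpr (mul_nonpos_of_nonpos_of_nonneg (by linarith) (by positivity)))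
      _ ≤ (K₁ + K₂) * M := by gcongr; linarith
  rcases max_choice ‖p.1‖ ‖p.2‖ with hp | hp <;> rw [Prod.norm_def, hp]
  · refine (hposition f M hb p).trans ?_
    gcongr
    · exact le_add_of_nonneg_right (by positivity)
    · exact min_le_left _ _
  · refine (hdecay p.2 _ ((K₁ + K₂) * M) (norm_nonneg _) hbound fun j n => ?_).trans ?_
    · refine (hfrequency f M hf hb p j n).trans ?_
      gcongr
      linarith
    · rw [← mul_assoc]
      gcongr
      · exact le_add_of_nonneg_left hK₁
      · exact min_le_right _ _

/-! ### The adjoint short-time Fourier transform and the localization operator -/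

theorem conj_gaborAtom (p : Rd d × Rd d) (y : Rd d) :
    conj (gaborAtom p y) = gaborAtom (p.1, -p.2) y := by
  simp only [gaborAtom, map_mul, Complex.conj_ofReal, ← Complex.exp_conj, map_neg, Complex.conj_I,
    inner_neg_left, Complex.ofReal_neg]
  congr 2
  ring

theorem conj_stftFun_conj (f : Rd d → ℂ) (p : Rd d × Rd d) :
    conj (stftFun (fun y => conj (f y)) p) = stftFun f (p.1, -p.2) := by
  rw [stftFun, map_mul, Complex.conj_ofReal, ← integral_conj, stftFun]
  simp only [map_mul, Complex.conj_conj, conj_gaborAtom]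

theorem continuous_uncurry_gaborAtom :
    Continuous fun q : (Rd d × Rd d) × Rd d => gaborAtom q.1 q.2 := by
  unfold gaborAtom gaussWindow
  fun_prop

theorem integrable_gaborAtom (p : Rd d × Rd d) : Integrable (gaborAtom p) :=
  ((integrable_exp_neg_mul_norm_sub_sq (by norm_num) p.1).const_mul _).mono'
    (gaborAtom_mem le_rfl p).1.continuous.aestronglyMeasurable
    (Filter.Eventually.of_forall fun y => (norm_gaborAtom p y).le)

theorem integrable_mul_gaborAtom (f : GS θ d) (p : Rd d × Rd d) :
    Integrable fun y => (f : Rd d → ℂ) y * gaborAtom p y := by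
  obtain ⟨hf, h, -, M, hb⟩ := f.2
  exact (integrable_gaborAtom p).bdd_mul hf.continuous.aestronglyMeasurable
    (Filter.Eventually.of_forall hb.norm_le)

theorem stftFun_add (f g : GS θ d) (p : Rd d × Rd d) :
    stftFun ((f + g : GS θ d) : Rd d → ℂ) p =
      stftFun (f : Rd d → ℂ) p + stftFun (g : Rd d → ℂ) p := by
  simp only [stftFun, Submodule.coe_add, Pi.add_apply, add_mul]
  rw [integral_add (integrable_mul_gaborAtom f p) (integrable_mul_gaborAtom g p), mul_add]

theorem stftFun_smul (c : ℂ) (f : Rd d → ℂ) (p : Rd d × Rd d) :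
    stftFun (c • f) p = c * stftFun f p := by
  simp only [stftFun, Pi.smul_apply, smul_eq_mul, mul_assoc]
  rw [integral_const_mul, mul_left_comm]

theorem stronglyMeasurable_stftFun {f : Rd d → ℂ} (hf : Continuous f) :
    StronglyMeasurable (stftFun f) := by
  have hcont : Continuous fun q : (Rd d × Rd d) × Rd d => f q.2 * gaborAtom q.1 q.2 :=
    (hf.comp continuous_snd).mul continuous_uncurry_gaborAtom
  exact (hcont.stronglyMeasurable.integral_prod_right' (ν := (volume : Measure (Rd d)))).const_mul _

/-- Subexponential growth of order `1/θ`: `‖F x‖ = O(e^{δ‖x‖^{1/θ}})` almost everywhere, for every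
`δ > 0`. This is the growth allowed for the symbols of localization operators. -/
def HasSubexponentialGrowth {E : Type*} [NormedAddCommGroup E] [MeasureSpace E] (θ : ℝ)
    (F : E → ℂ) : Prop :=
  ∀ δ > 0, ∃ C : ℝ, ∀ᵐ x, ‖F x‖ ≤ C * Real.exp (δ * ‖x‖ ^ (1 / θ))

namespace HasSubexponentialGrowth

theorem of_norm_prod_le {E E' : Type*} [NormedAddCommGroup E] [MeasureSpace E]
    [NormedAddCommGroup E'] [MeasureSpace E'] {F : E × E' → ℂ} (hθ : 0 ≤ θ)
    (hF : ∀ δ > 0, ∃ C : ℝ, ∀ᵐ p : E × E',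
      ‖F p‖ ≤ C * Real.exp (δ * (‖p.1‖ ^ (1 / θ) + ‖p.2‖ ^ (1 / θ)))) :
    HasSubexponentialGrowth θ F := fun δ hδ => by
  obtain ⟨C, hC⟩ := hF (δ / 2) (by positivity)
  refine ⟨|C|, hC.mono fun p hp => hp.trans ?_⟩
  have hfst : ‖p.1‖ ^ (1 / θ) ≤ ‖p‖ ^ (1 / θ) := by gcongr; exact norm_fst_le p
  have hsnd : ‖p.2‖ ^ (1 / θ) ≤ ‖p‖ ^ (1 / θ) := by gcongr; exact norm_snd_le p
  refine mul_le_mul (le_abs_self C) (Real.exp_le_exp.mpr ?_) (Real.exp_pos _).le (abs_nonneg C)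
  nlinarith

theorem mul {E : Type*} [NormedAddCommGroup E] [MeasureSpace E] {F G : E → ℂ}
    (hF : HasSubexponentialGrowth θ F) (hG : HasSubexponentialGrowth θ G) :
    HasSubexponentialGrowth θ fun x => F x * G x := fun δ hδ => by
  obtain ⟨C, hC⟩ := hF (δ / 2) (by positivity)
  obtain ⟨D, hD⟩ := hG (δ / 2) (by positivity)
  refine ⟨C * D, ?_⟩
  filter_upwards [hC, hD] with x hCx hDx
  calc ‖F x * G x‖ = ‖F x‖ * ‖G x‖ := norm_mul _ _
    _ ≤ C * Real.exp (δ / 2 * ‖x‖ ^ (1 / θ)) * (D * Real.exp (δ / 2 * ‖x‖ ^ (1 / θ))) :=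
      mul_le_mul hCx hDx (norm_nonneg _) ((norm_nonneg _).trans hCx)
    _ = C * D * Real.exp (δ / 2 * ‖x‖ ^ (1 / θ) + δ / 2 * ‖x‖ ^ (1 / θ)) := by
      rw [Real.exp_add]
      ring
    _ = C * D * Real.exp (δ * ‖x‖ ^ (1 / θ)) := by
      congr 2
      ring

theorem exists_norm_mul_conj_stftFun_le {F : Rd d × Rd d → ℂ}
    (hF : HasSubexponentialGrowth θ F) (hθ : 1 / 2 ≤ θ) {h : ℝ} (hh : 0 < h) :
    ∃ ε > 0, ∃ C : ℝ, ∀ (f : Rd d → ℂ) (M : ℝ), ContDiff ℝ ∞ f → GSBound θ h M f →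
      ∀ᵐ p, ‖F p * conj (stftFun (fun y => conj (f y)) p)‖ ≤
        C * M * Real.exp (-ε * ‖p‖ ^ (1 / θ)) := by
  obtain ⟨ε, hε, K, hdecay⟩ := exists_norm_stftFun_le d hθ hh
  obtain ⟨C, hC⟩ := hF (ε / 2) (by positivity)
  refine ⟨ε / 2, by positivity, C * K, fun f M hf hb => hC.mono fun p hp => ?_⟩
  have hreflect : ‖((p.1, -p.2) : Rd d × Rd d)‖ = ‖p‖ := by simp only [Prod.norm_def, norm_neg]
  rw [conj_stftFun_conj]
  calc ‖F p * stftFun f (p.1, -p.2)‖ = ‖F p‖ * ‖stftFun f (p.1, -p.2)‖ := norm_mul _ _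
    _ ≤ C * Real.exp (ε / 2 * ‖p‖ ^ (1 / θ)) * (K * M * Real.exp (-ε * ‖p‖ ^ (1 / θ))) :=
      mul_le_mul hp (hreflect ▸ hdecay f M hf hb (p.1, -p.2)) (norm_nonneg _)
        ((norm_nonneg _).trans hp)
    _ = C * K * M * Real.exp (ε / 2 * ‖p‖ ^ (1 / θ) + -ε * ‖p‖ ^ (1 / θ)) := by
      rw [Real.exp_add]
      ring
    _ = C * K * M * Real.exp (-(ε / 2) * ‖p‖ ^ (1 / θ)) := by
      congr 2
      ring

end HasSubexponentialGrowth

theorem hasSubexponentialGrowth_stftDual (hθ : 1 / 2 ≤ θ) (u : GSDual θ d) :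
    HasSubexponentialGrowth θ (stftDual hθ u) := fun _ hδ =>
  (exists_norm_stftDual_le hθ u hδ).imp fun _ hC => Filter.Eventually.of_forall hC

instance isAddHaarMeasure_phaseSpace (d : ℕ) :
    (volume : Measure (Rd d × Rd d)).IsAddHaarMeasure :=
  Measure.prod.instIsAddHaarMeasure _ _

section Adjoint

variable {F : Rd d × Rd d → ℂ}

theorem integrable_mul_conj_stftFun (hθ : 1 / 2 ≤ θ) (hF : AEStronglyMeasurable F volume)
    (hgrowth : HasSubexponentialGrowth θ F) (f : GS θ d) :
    Integrable fun p => F p * conj (stftFun (fun y => conj ((f : Rd d → ℂ) y)) p) := by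
  obtain ⟨hf, h, hh, M, hb⟩ := f.2
  obtain ⟨ε, hε, C, hC⟩ := hgrowth.exists_norm_mul_conj_stftFun_le hθ hh
  have hmeas : StronglyMeasurable (stftFun fun y => conj ((f : Rd d → ℂ) y)) :=
    stronglyMeasurable_stftFun (Complex.continuous_conj.comp hf.continuous)
  exact ((integrable_exp_neg_mul_norm_rpow volume (by linarith) hε).const_mul (C * M)).mono'
    (hF.mul (Complex.continuous_conj.comp_stronglyMeasurable hmeas).aestronglyMeasurable)
    (hC f M hf hb)

/-- The adjoint short-time Fourier transform `V_ψ^* F`, the ultradistribution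
`f ↦ ∫ F \overline{V_ψ \bar f}`. -/
noncomputable def stftAdjoint (hθ : 1 / 2 ≤ θ) (hF : AEStronglyMeasurable F volume)
    (hgrowth : HasSubexponentialGrowth θ F) : GSDual θ d where
  val :=
    { toFun f := ∫ p, F p * conj (stftFun (fun y => conj ((f : Rd d → ℂ) y)) p)
      map_add' f g := by
        rw [← integral_add (integrable_mul_conj_stftFun hθ hF hgrowth f)
          (integrable_mul_conj_stftFun hθ hF hgrowth g)]
        simp only [conj_stftFun_conj, stftFun_add, mul_add]
      map_smul' c f := by
        rw [RingHom.id_apply, smul_eq_mul, ← integral_const_mul]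
        simp only [conj_stftFun_conj, Submodule.coe_smul, stftFun_smul, mul_left_comm] }
  property h hh := by
    obtain ⟨ε, hε, C, hC⟩ := hgrowth.exists_norm_mul_conj_stftFun_le hθ hh
    have hint : Integrable fun p : Rd d × Rd d => Real.exp (-ε * ‖p‖ ^ (1 / θ)) :=
      integrable_exp_neg_mul_norm_rpow volume (by linarith) hε
    refine ⟨C * ∫ p : Rd d × Rd d, Real.exp (-ε * ‖p‖ ^ (1 / θ)), fun f M hb => ?_⟩
    refine (norm_integral_le_of_norm_le (hint.const_mul (C * M)) (hC f M f.2.1 hb)).trans_eq ?_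
    rw [integral_const_mul]
    ring

theorem stftAdjoint_apply (hθ : 1 / 2 ≤ θ) (hF : AEStronglyMeasurable F volume)
    (hgrowth : HasSubexponentialGrowth θ F) (f : GS θ d) :
    (stftAdjoint hθ hF hgrowth).1 f =
      ∫ p, F p * conj (stftFun (fun y => conj ((f : Rd d → ℂ) y)) p) := rfl

end Adjoint

section LocalizationOperator

variable {a : Rd d × Rd d → ℂ}

theorem stftDual_add (hθ : 1 / 2 ≤ θ) (u v : GSDual θ d) (p : Rd d × Rd d) :
    stftDual hθ (u + v) p = stftDual hθ u p + stftDual hθ v p := mul_add _ _ _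

theorem stftDual_smul (hθ : 1 / 2 ≤ θ) (c : ℂ) (u : GSDual θ d) (p : Rd d × Rd d) :
    stftDual hθ (c • u) p = c * stftDual hθ u p := mul_left_comm _ _ _

theorem aestronglyMeasurable_mul_stftDual (hθ : 1 / 2 ≤ θ) (ha : AEStronglyMeasurable a volume)
    (u : GSDual θ d) : AEStronglyMeasurable (fun p => a p * stftDual hθ u p) volume :=
  ha.mul (continuous_stftDual hθ u).aestronglyMeasurable

/-- The localization operator `A_a^ψ = V_ψ^* a V_ψ` on ultradistributions. -/
noncomputable def localizationOperator (hθ : 1 / 2 ≤ θ) (ha : AEStronglyMeasurable a volume)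
    (hgrowth : HasSubexponentialGrowth θ a) : GSDual θ d →ₗ[ℂ] GSDual θ d where
  toFun u := stftAdjoint hθ (aestronglyMeasurable_mul_stftDual hθ ha u)
    (hgrowth.mul (hasSubexponentialGrowth_stftDual hθ u))
  map_add' u v := Subtype.ext <| LinearMap.ext fun f => by
    rw [Submodule.coe_add, LinearMap.add_apply, stftAdjoint_apply, stftAdjoint_apply,
      stftAdjoint_apply, ← integral_add
        (integrable_mul_conj_stftFun hθ (aestronglyMeasurable_mul_stftDual hθ ha u)
          (hgrowth.mul (hasSubexponentialGrowth_stftDual hθ u)) f)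
        (integrable_mul_conj_stftFun hθ (aestronglyMeasurable_mul_stftDual hθ ha v)
          (hgrowth.mul (hasSubexponentialGrowth_stftDual hθ v)) f)]
    simp only [stftDual_add, mul_add, add_mul]
  map_smul' c u := Subtype.ext <| LinearMap.ext fun f => by
    rw [RingHom.id_apply, Submodule.coe_smul, LinearMap.smul_apply, stftAdjoint_apply,
      stftAdjoint_apply, smul_eq_mul, ← integral_const_mul]
    simp only [stftDual_smul, mul_left_comm (a _), mul_assoc]

theorem existsUnique_isLocalizationOperator (hθ : 1 / 2 ≤ θ) (ha : AEStronglyMeasurable a volume)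
    (hgrowth : HasSubexponentialGrowth θ a) :
    ∃! A : GSDual θ d →ₗ[ℂ] GSDual θ d, IsLocalizationOperator hθ a A := by
  refine ⟨localizationOperator hθ ha hgrowth, fun u f =>
    ⟨integrable_mul_conj_stftFun hθ (aestronglyMeasurable_mul_stftDual hθ ha u)
      (hgrowth.mul (hasSubexponentialGrowth_stftDual hθ u)) f, rfl⟩, fun A hA => ?_⟩
  exact LinearMap.ext fun u => Subtype.ext (LinearMap.ext fun f => (hA u f).2)

end LocalizationOperator

/-! ### Microlocality -/

theorem norm_chi_sq (p : Rd d × Rd d) : ‖chi p‖ ^ 2 = ‖p.1‖ ^ 2 + ‖p.2‖ ^ 2 := by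
  rw [EuclideanSpace.norm_sq_eq, EuclideanSpace.real_norm_sq_eq, EuclideanSpace.real_norm_sq_eq,
    ← Finset.sum_add_distrib]
  refine Finset.sum_congr rfl fun j _ => ?_
  rw [chi_apply, Complex.sq_norm, Complex.normSq_apply]
  simp only [Complex.sub_re, Complex.sub_im, Complex.neg_re, Complex.neg_im, Complex.mul_re,
    Complex.mul_im, Complex.ofReal_re, Complex.ofReal_im, Complex.I_re, Complex.I_im]
  ring

theorem chi_sub (p q : Rd d × Rd d) : chi (p - q) = chi p - chi q := by
  ext j
  simp only [chi_apply, PiLp.sub_apply, Prod.fst_sub, Prod.snd_sub, Complex.ofReal_sub]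
  ring

theorem chi_surjective : Function.Surjective (chi : Rd d × Rd d → Cd d) := by
  intro z
  refine ⟨(WithLp.toLp 2 fun j => -(z j).im, WithLp.toLp 2 fun j => -(z j).re), ?_⟩
  ext j
  rw [chi_apply]
  apply Complex.ext <;> simp

theorem norm_le_norm_chi (p : Rd d × Rd d) : ‖p‖ ≤ ‖chi p‖ := by
  have hsq := norm_chi_sq p
  exact max_le (le_of_sq_le_sq (by nlinarith [sq_nonneg ‖p.2‖]) (norm_nonneg _))
    (le_of_sq_le_sq (by nlinarith [sq_nonneg ‖p.1‖]) (norm_nonneg _))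

theorem fbiWeight_chi (p : Rd d × Rd d) : fbiWeight (chi p) = ‖p.1‖ ^ 2 / 2 := by
  rw [fbiWeight, EuclideanSpace.real_norm_sq_eq]
  simp [chi_apply]

theorem exists_norm_stftDual_eq_fbi (hθ : 1 / 2 ≤ θ) (u : GSDual θ d) :
    ∃ κ > 0, ∀ p, ‖stftDual hθ u p‖ =
      κ * Real.exp (-fbiWeight (chi p)) * ‖fbi hθ u (chi p)‖ := by
  set k : ℝ := (2 : ℝ) ^ (-(d : ℝ) / 2) * Real.pi ^ (-(3 * d : ℝ) / 4)
  have hk : 0 < k := by positivity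
  refine ⟨(2 * Real.pi) ^ (-(d : ℝ) / 2) * Real.pi ^ (-(d : ℝ) / 4) / k, by positivity,
    fun p => ?_⟩
  rw [stftDual_eq, fbi, fbiWeight_chi]
  rw [norm_mul, norm_mul, norm_mul, Complex.norm_real, Complex.norm_real, Complex.norm_real,
    Real.norm_of_nonneg (by positivity), Real.norm_of_nonneg (by positivity),
    Real.norm_of_nonneg hk.le, neg_div]
  field_simp

theorem mem_WFgl_iff (hθ : 1 / 2 ≤ θ) (u : GSDual θ d) (p₀ : Rd d × Rd d) :
    p₀ ∈ WFgl hθ u ↔ p₀ ≠ 0 ∧ ¬ ∃ Γ : Set (Cd d), IsOpen Γ ∧ IsConic Γ ∧ chi p₀ ∈ Γ ∧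
      ∃ ε > 0, ∃ C : ℝ, ∀ p, chi p ∈ Γ →
        ‖stftDual hθ u p‖ ≤ C * Real.exp (-ε * ‖chi p‖ ^ (1 / θ)) := by
  obtain ⟨κ, hκ, hfbi⟩ := exists_norm_stftDual_eq_fbi hθ u
  have hscale : ∀ (C t : ℝ) (p : Rd d × Rd d),
      ‖fbi hθ u (chi p)‖ ≤ C * Real.exp (t + fbiWeight (chi p)) ↔
        ‖stftDual hθ u p‖ ≤ κ * C * Real.exp t := fun C t p => by
    have hpos : 0 < κ * Real.exp (-fbiWeight (chi p)) := by positivity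
    rw [hfbi, ← mul_le_mul_iff_right₀ hpos, show κ * Real.exp (-fbiWeight (chi p)) *
      (C * Real.exp (t + fbiWeight (chi p))) = κ * C * Real.exp t by
        rw [Real.exp_add, Real.exp_neg]; field_simp]
  simp only [WFgl, Set.mem_ofPred_eq, chi_surjective.forall, hscale]
  refine and_congr_right fun _ => not_congr <| exists_congr fun Γ => and_congr_right fun _ =>
    and_congr_right fun _ => and_congr_right fun _ => exists_congr fun ε =>
    and_congr_right fun _ => ?_
  exact ⟨fun ⟨C, hC⟩ => ⟨κ * C, hC⟩, fun ⟨C, hC⟩ => ⟨κ⁻¹ * C, fun p hp => by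
    simpa only [mul_inv_cancel_left₀ hκ.ne'] using hC p hp⟩⟩

theorem exp_neg_mul_norm_chi_sq (b : ℝ) (p : Rd d × Rd d) :
    Real.exp (-b * ‖chi p‖ ^ 2) = Real.exp (-b * ‖p.1‖ ^ 2) * Real.exp (-b * ‖p.2‖ ^ 2) := by
  rw [norm_chi_sq, mul_add, Real.exp_add]

theorem integrable_exp_neg_mul_norm_chi_sq (d : ℕ) {b : ℝ} (hb : 0 < b) :
    Integrable fun p : Rd d × Rd d => Real.exp (-b * ‖chi p‖ ^ 2) := by
  have hint : Integrable fun x : Rd d => Real.exp (-b * ‖x‖ ^ 2) := by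
    simpa only [sub_zero] using integrable_exp_neg_mul_norm_sub_sq hb (0 : Rd d)
  simp only [exp_neg_mul_norm_chi_sq]
  exact hint.mul_prod hint

theorem norm_integral_le_of_norm_le_gaussian_chi {F : Rd d × Rd d → ℂ} {b D : ℝ} (hb : 0 < b)
    (q : Rd d × Rd d) (hF : ∀ᵐ p, ‖F p‖ ≤ D * Real.exp (-b * ‖chi p - chi q‖ ^ 2)) :
    ‖∫ p, F p‖ ≤ D * ∫ p : Rd d × Rd d, Real.exp (-b * ‖chi p‖ ^ 2) := by
  simp only [← chi_sub] at hF
  calc ‖∫ p, F p‖ ≤ ∫ p, D * Real.exp (-b * ‖chi (p - q)‖ ^ 2) :=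
        norm_integral_le_of_norm_le
          (((integrable_exp_neg_mul_norm_chi_sq d hb).comp_sub_right q).const_mul D) hF
    _ = _ := by
        rw [integral_const_mul,
          integral_sub_right_eq_self (fun p : Rd d × Rd d => Real.exp (-b * ‖chi p‖ ^ 2)) q]

theorem norm_add_midpoint_sub_sq_add {V : Type*} [NormedAddCommGroup V] [InnerProductSpace ℝ V]
    (x y v : V) :
    ‖v + (1 / 2 : ℝ) • (x + y) - x‖ ^ 2 + ‖v + (1 / 2 : ℝ) • (x + y) - y‖ ^ 2 =
      2 * ‖v‖ ^ 2 + ‖x - y‖ ^ 2 / 2 := by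
  rw [show v + (1 / 2 : ℝ) • (x + y) - x = v - (1 / 2 : ℝ) • (x - y) by module,
    show v + (1 / 2 : ℝ) • (x + y) - y = v + (1 / 2 : ℝ) • (x - y) by module,
    norm_add_sq_real, norm_sub_sq_real, norm_smul, Real.norm_of_nonneg (by norm_num)]
  ring

theorem gaborAtom_mul_gaborAtom (p q : Rd d × Rd d) (v : Rd d) :
    gaborAtom q (v + (1 / 2 : ℝ) • (p.1 + q.1)) *
        gaborAtom (p.1, -p.2) (v + (1 / 2 : ℝ) • (p.1 + q.1)) =
      (((Real.pi ^ (-(d : ℝ) / 4)) ^ 2 * Real.exp (-(1 / 4) * ‖p.1 - q.1‖ ^ 2) : ℝ) : ℂ) *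
        Complex.exp (-(Complex.I * (inner ℝ (q.2 - p.2) ((1 / 2 : ℝ) • (p.1 + q.1)) : ℝ))) *
        Complex.exp (-1 * ‖v‖ ^ 2 + -Complex.I * (inner ℝ (q.2 - p.2) v : ℝ)) := by
  have hmid : (‖v + (1 / 2 : ℝ) • (p.1 + q.1) - p.1‖ : ℂ) ^ 2 +
      (‖v + (1 / 2 : ℝ) • (p.1 + q.1) - q.1‖ : ℂ) ^ 2 =
        2 * (‖v‖ : ℂ) ^ 2 + (‖p.1 - q.1‖ : ℂ) ^ 2 / 2 := by
    exact_mod_cast norm_add_midpoint_sub_sq_add p.1 q.1 v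
  set m : Rd d := (1 / 2 : ℝ) • (p.1 + q.1)
  simp only [gaborAtom, gaussWindow, inner_add_right, inner_neg_left, inner_sub_left,
    Complex.ofReal_mul, Complex.ofReal_pow, Complex.ofReal_exp]
  set c : ℂ := ((Real.pi ^ (-(d : ℝ) / 4) : ℝ) : ℂ)
  have hcombine : ∀ A B C D : ℂ, c * Complex.exp A * Complex.exp B *
      (c * Complex.exp C * Complex.exp D) = c ^ 2 * Complex.exp (A + B + C + D) :=
    fun A B C D => by
      rw [Complex.exp_add, Complex.exp_add, Complex.exp_add]
      ring
  rw [hcombine, mul_assoc (c ^ 2), mul_assoc (c ^ 2), ← Complex.exp_add, ← Complex.exp_add]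
  congr 2
  push_cast
  linear_combination (-1 / 2 : ℂ) * hmid

theorem exists_norm_stftFun_gaborAtom_le (d : ℕ) :
    ∃ C : ℝ, ∀ p q : Rd d × Rd d,
      ‖conj (stftFun (fun y => conj (gaborAtom q y)) p)‖ ≤
        C * Real.exp (-(1 / 4) * ‖chi p - chi q‖ ^ 2) := by
  refine ⟨(2 * Real.pi) ^ (-(d : ℝ) / 2) * ((Real.pi ^ (-(d : ℝ) / 4)) ^ 2 *
    ‖((Real.pi : ℂ) / 1) ^ ((Module.finrank ℝ (Rd d) : ℂ) / 2)‖), fun p q => ?_⟩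
  have hfourier : ‖Complex.exp ((-Complex.I) ^ 2 * (‖q.2 - p.2‖ : ℂ) ^ 2 / (4 * 1))‖ =
      Real.exp (-(1 / 4) * ‖p.2 - q.2‖ ^ 2) := by
    rw [neg_sq, Complex.I_sq, Complex.norm_exp, norm_sub_rev]
    norm_cast
    congr 1
    push_cast
    ring
  -- Recentring at the midpoint of the two atoms leaves the Fourier transform of a Gaussian.
  rw [conj_stftFun_conj, stftFun, norm_mul, Complex.norm_real, Real.norm_of_nonneg (by positivity),
    ← integral_add_right_eq_self _ ((1 / 2 : ℝ) • (p.1 + q.1))]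
  simp only [gaborAtom_mul_gaborAtom]
  rw [integral_const_mul, GaussianFourier.integral_cexp_neg_mul_sq_norm_add (by simp), norm_mul,
    norm_mul, norm_mul, Complex.norm_real, Real.norm_of_nonneg (by positivity),
    norm_exp_neg_I_mul_ofReal, hfourier, ← chi_sub, exp_neg_mul_norm_chi_sq, Prod.fst_sub,
    Prod.snd_sub]
  exact le_of_eq (by ring)

theorem mul_norm_le_norm_sub_of_smul {𝕜 E : Type*} [NormedField 𝕜] [NormedAddCommGroup E]
    [NormedSpace 𝕜 E] {s : 𝕜} {z₀ v w : E} {r : ℝ} (hs : s ≠ 0) (hr : 0 < r)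
    (hv : ‖s • v - z₀‖ ≤ r) (hw : 2 * r ≤ ‖s • w - z₀‖) :
    r / (‖z₀‖ + r) * ‖v‖ ≤ ‖w - v‖ := by
  have hsep : r ≤ ‖s‖ * ‖w - v‖ := by
    have htri := norm_sub_norm_le (s • w - z₀) (s • v - z₀)
    rw [sub_sub_sub_cancel_right, ← smul_sub, norm_smul] at htri
    linarith
  have hsize : ‖s‖ * ‖v‖ ≤ ‖z₀‖ + r := by
    have htri := norm_le_norm_add_norm_sub' (s • v) z₀
    rw [norm_smul] at htri
    linarith
  rw [div_mul_eq_mul_div, div_le_iff₀ (by positivity)]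
  refine le_of_mul_le_mul_left ?_ (norm_pos_iff.mpr hs)
  calc ‖s‖ * (r * ‖v‖) = r * (‖s‖ * ‖v‖) := by ring
    _ ≤ (‖s‖ * ‖w - v‖) * (‖z₀‖ + r) := by gcongr
    _ = ‖s‖ * (‖w - v‖ * (‖z₀‖ + r)) := by ring

theorem IsConic.smul_mem_iff {Γ : Set (Cd d)} (hΓ : IsConic Γ) {s : ℝ} (hs : 0 < s) {z : Cd d} :
    (s : ℂ) • z ∈ Γ ↔ z ∈ Γ := by
  refine ⟨fun hz => ?_, hΓ s hs z⟩
  have hback := hΓ s⁻¹ (inv_pos.mpr hs) _ hz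
  rwa [smul_smul, ← Complex.ofReal_mul, inv_mul_cancel₀ hs.ne', Complex.ofReal_one,
    one_smul] at hback

theorem IsConic.exists_isOpen_separated {Γ : Set (Cd d)} (hΓ : IsConic Γ) (hopen : IsOpen Γ)
    {z₀ : Cd d} (hz₀ : z₀ ∈ Γ) :
    ∃ Γ' : Set (Cd d), IsOpen Γ' ∧ IsConic Γ' ∧ z₀ ∈ Γ' ∧
      ∃ c > 0, ∀ z ∈ Γ', ∀ w ∉ Γ, c * ‖z‖ ≤ ‖w - z‖ := by
  obtain ⟨ρ, hρ, hball⟩ := Metric.isOpen_iff.mp hopen z₀ hz₀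
  refine ⟨{z | ∃ s : ℝ, 0 < s ∧ ‖(s : ℂ) • z - z₀‖ < ρ / 2}, ?_, ?_,
    ⟨1, one_pos, by simpa using hρ⟩, ρ / 2 / (‖z₀‖ + ρ / 2), by positivity, ?_⟩
  · simp only [Set.ofPred_exists, Set.ofPred_and]
    exact isOpen_iUnion fun s => isOpen_const.inter (isOpen_lt (by fun_prop) continuous_const)
  · rintro t ht z ⟨s, hs, hz⟩
    refine ⟨s / t, by positivity, ?_⟩
    rwa [smul_smul, ← Complex.ofReal_mul, div_mul_cancel₀ _ ht.ne']
  · rintro z ⟨s, hs, hz⟩ w hw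
    refine mul_norm_le_norm_sub_of_smul (Complex.ofReal_ne_zero.mpr hs.ne') (by positivity) hz.le ?_
    by_contra! hlt
    refine hw ((hΓ.smul_mem_iff hs).mp (hball ?_))
    rw [Metric.mem_ball, dist_eq_norm]
    linarith

section Exponents

variable {E : Type*} [SeminormedAddCommGroup E]

theorem neg_mul_norm_rpow_le_add_norm_sub_sq {ε : ℝ} (hθ : 1 / 2 ≤ θ) (hε : 0 ≤ ε)
    (hε' : ε ≤ 1 / 8) (v w : E) :
    -ε * ‖w‖ ^ (1 / θ) ≤ 1 - ε / 4 * ‖v‖ ^ (1 / θ) + 1 / 8 * ‖w - v‖ ^ 2 := by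
  have hsub := mul_le_mul_of_nonneg_left (norm_rpow_one_div_le_of_sub hθ v w) hε
  rw [norm_sub_rev] at hsub
  nlinarith [mul_le_mul_of_nonneg_right hε' (sq_nonneg ‖w - v‖)]

theorem mul_norm_rpow_le_of_mul_norm_le_norm_sub {c δ : ℝ} (hθ : 1 / 2 ≤ θ) (hc : 0 < c)
    (hδ : 0 ≤ δ) (hδ' : 72 * δ ≤ min 1 (c ^ 2)) {v w : E} (hsep : c * ‖v‖ ≤ ‖w - v‖) :
    δ * ‖w‖ ^ (1 / θ) ≤ 1 - δ * ‖v‖ ^ (1 / θ) + 1 / 8 * ‖w - v‖ ^ 2 := by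
  have hδ1 : 72 * δ ≤ 1 := hδ'.trans (min_le_left _ _)
  have hδc : 72 * δ ≤ c ^ 2 := hδ'.trans (min_le_right _ _)
  have hw := mul_le_mul_of_nonneg_left (norm_rpow_one_div_le_of_sub hθ w v) hδ
  have hv := mul_le_mul_of_nonneg_left (rpow_one_div_le_one_add_sq hθ (norm_nonneg v)) hδ
  have hfar : 72 * δ * ‖v‖ ^ 2 ≤ ‖w - v‖ ^ 2 :=
    calc 72 * δ * ‖v‖ ^ 2 ≤ c ^ 2 * ‖v‖ ^ 2 := by gcongr
      _ = (c * ‖v‖) ^ 2 := by ring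
      _ ≤ ‖w - v‖ ^ 2 := by gcongr
  nlinarith [mul_le_mul_of_nonneg_right hδ1 (sq_nonneg ‖w - v‖)]

end Exponents

theorem HasSubexponentialGrowth.exists_norm_mul_le_exp_neg {a G : Rd d × Rd d → ℂ}
    (ha : HasSubexponentialGrowth θ a) (hθ : 0 ≤ θ) {Γ : Set (Cd d)} {ε C : ℝ} (hε : 0 < ε)
    (hG : ∀ p, chi p ∈ Γ → ‖G p‖ ≤ C * Real.exp (-ε * ‖chi p‖ ^ (1 / θ))) :
    ∃ C' : ℝ, ∀ᵐ p, chi p ∈ Γ →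
      ‖a p * G p‖ ≤ C' * Real.exp (-(ε / 2) * ‖chi p‖ ^ (1 / θ)) := by
  obtain ⟨D, hD⟩ := ha (ε / 2) (by positivity)
  refine ⟨|D| * C, ?_⟩
  filter_upwards [hD] with p hDp hp
  have hDp' : ‖a p‖ ≤ |D| * Real.exp (ε / 2 * ‖chi p‖ ^ (1 / θ)) := by
    refine hDp.trans ?_
    gcongr
    · exact le_abs_self D
    · exact norm_le_norm_chi p
  calc ‖a p * G p‖ = ‖a p‖ * ‖G p‖ := norm_mul _ _
    _ ≤ |D| * Real.exp (ε / 2 * ‖chi p‖ ^ (1 / θ)) *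
          (C * Real.exp (-ε * ‖chi p‖ ^ (1 / θ))) :=
      mul_le_mul hDp' (hG p hp) (norm_nonneg _) (by positivity)
    _ = |D| * C * Real.exp (ε / 2 * ‖chi p‖ ^ (1 / θ) + -ε * ‖chi p‖ ^ (1 / θ)) := by
      rw [Real.exp_add]
      ring
    _ = |D| * C * Real.exp (-(ε / 2) * ‖chi p‖ ^ (1 / θ)) := by
      congr 2
      ring

theorem HasSubexponentialGrowth.exists_norm_le_exp_add_norm_chi_sub_sq {F : Rd d × Rd d → ℂ}
    (hF : HasSubexponentialGrowth θ F) (hθ : 1 / 2 ≤ θ) {Γ Γ' : Set (Cd d)} {c ε C : ℝ}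
    (hc : 0 < c) (hsep : ∀ z ∈ Γ', ∀ w ∉ Γ, c * ‖z‖ ≤ ‖w - z‖) (hε : 0 < ε)
    (hdecay : ∀ᵐ p, chi p ∈ Γ → ‖F p‖ ≤ C * Real.exp (-ε * ‖chi p‖ ^ (1 / θ))) :
    ∃ η > 0, ∃ D : ℝ, ∀ᵐ p, ∀ q, chi q ∈ Γ' →
      ‖F p‖ ≤ D * Real.exp (1 - η * ‖chi q‖ ^ (1 / θ) + 1 / 8 * ‖chi p - chi q‖ ^ 2) := by
  set ε₁ : ℝ := min ε (1 / 8)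
  set δ : ℝ := min 1 (c ^ 2) / 72 with hδdef
  have hε₁ : 0 < ε₁ := lt_min hε (by norm_num)
  have hδ : 0 < δ := by positivity
  obtain ⟨K, hK⟩ := hF δ hδ
  refine ⟨min (ε₁ / 4) δ, lt_min (by positivity) hδ, max |C| |K|, ?_⟩
  filter_upwards [hdecay, hK] with p hCp hKp q hq
  by_cases hp : chi p ∈ Γ
  · calc ‖F p‖ ≤ C * Real.exp (-ε * ‖chi p‖ ^ (1 / θ)) := hCp hp
      _ ≤ max |C| |K| * Real.exp (-ε₁ * ‖chi p‖ ^ (1 / θ)) := by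
        gcongr
        · exact (le_abs_self C).trans (le_max_left _ _)
        · exact min_le_left _ _
      _ ≤ max |C| |K| *
            Real.exp (1 - ε₁ / 4 * ‖chi q‖ ^ (1 / θ) + 1 / 8 * ‖chi p - chi q‖ ^ 2) := by
        gcongr ?_ * Real.exp ?_
        exact neg_mul_norm_rpow_le_add_norm_sub_sq hθ hε₁.le (min_le_right _ _) _ _
      _ ≤ _ := by
        gcongr
        exact min_le_left _ _
  · calc ‖F p‖ ≤ K * Real.exp (δ * ‖p‖ ^ (1 / θ)) := hKp
      _ ≤ max |C| |K| * Real.exp (δ * ‖chi p‖ ^ (1 / θ)) := by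
        gcongr
        · exact (le_abs_self K).trans (le_max_right _ _)
        · exact norm_le_norm_chi p
      _ ≤ max |C| |K| *
            Real.exp (1 - δ * ‖chi q‖ ^ (1 / θ) + 1 / 8 * ‖chi p - chi q‖ ^ 2) := by
        gcongr ?_ * Real.exp ?_
        exact mul_norm_rpow_le_of_mul_norm_le_norm_sub hθ hc hδ.le
          (by rw [hδdef, mul_div_cancel₀ _ (by norm_num)]) (hsep _ hq _ hp)
      _ ≤ _ := by
        gcongr
        exact min_le_right _ _

theorem HasSubexponentialGrowth.exists_norm_stftDual_le_of_forall_apply_eq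
    {F : Rd d × Rd d → ℂ} (hF : HasSubexponentialGrowth θ F) (hθ : 1 / 2 ≤ θ) {w : GSDual θ d}
    (hw : ∀ f : GS θ d,
      w.1 f = ∫ p, F p * conj (stftFun (fun y => conj ((f : Rd d → ℂ) y)) p))
    {Γ Γ' : Set (Cd d)} {c ε C : ℝ} (hc : 0 < c)
    (hsep : ∀ z ∈ Γ', ∀ w ∉ Γ, c * ‖z‖ ≤ ‖w - z‖) (hε : 0 < ε)
    (hdecay : ∀ᵐ p, chi p ∈ Γ → ‖F p‖ ≤ C * Real.exp (-ε * ‖chi p‖ ^ (1 / θ))) :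
    ∃ η > 0, ∃ C' : ℝ, ∀ q, chi q ∈ Γ' →
      ‖stftDual hθ w q‖ ≤ C' * Real.exp (-η * ‖chi q‖ ^ (1 / θ)) := by
  obtain ⟨η, hη, D, hD⟩ := hF.exists_norm_le_exp_add_norm_chi_sub_sq hθ hc hsep hε hdecay
  obtain ⟨K, hkernel⟩ := exists_norm_stftFun_gaborAtom_le d
  refine ⟨η, hη, (2 * Real.pi) ^ (-(d : ℝ) / 2) * (D * K * Real.exp 1 *
    ∫ p : Rd d × Rd d, Real.exp (-(1 / 8) * ‖chi p‖ ^ 2)), fun q hq => ?_⟩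
  have hint := norm_integral_le_of_norm_le_gaussian_chi (by norm_num) q (hD.mono fun p hp =>
    calc ‖F p * conj (stftFun (fun y => conj (gaborAtom q y)) p)‖
        = ‖F p‖ * ‖conj (stftFun (fun y => conj (gaborAtom q y)) p)‖ := norm_mul _ _
      _ ≤ D * Real.exp (1 - η * ‖chi q‖ ^ (1 / θ) + 1 / 8 * ‖chi p - chi q‖ ^ 2) *
            (K * Real.exp (-(1 / 4) * ‖chi p - chi q‖ ^ 2)) :=
          mul_le_mul (hp q hq) (hkernel p q) (norm_nonneg _) ((norm_nonneg _).trans (hp q hq))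
      _ = D * K * Real.exp (1 - η * ‖chi q‖ ^ (1 / θ) + 1 / 8 * ‖chi p - chi q‖ ^ 2 +
            -(1 / 4) * ‖chi p - chi q‖ ^ 2) := by
          rw [Real.exp_add _ (-(1 / 4) * _)]
          ring
      _ = D * K * Real.exp (1 + -η * ‖chi q‖ ^ (1 / θ) +
            -(1 / 8) * ‖chi p - chi q‖ ^ 2) := by
          congr 2
          ring
      _ = D * K * Real.exp 1 * Real.exp (-η * ‖chi q‖ ^ (1 / θ)) *
            Real.exp (-(1 / 8) * ‖chi p - chi q‖ ^ 2) := by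
          rw [Real.exp_add, Real.exp_add]
          ring)
  rw [stftDual, hw, norm_mul, Complex.norm_real, Real.norm_of_nonneg (by positivity)]
  refine (mul_le_mul_of_nonneg_left hint (by positivity)).trans_eq ?_
  ring

theorem WFgl_subset_of_isLocalizationOperator (hθ : 1 / 2 ≤ θ) {a : Rd d × Rd d → ℂ}
    (hgrowth : HasSubexponentialGrowth θ a) {A : GSDual θ d →ₗ[ℂ] GSDual θ d}
    (hA : IsLocalizationOperator hθ a A) (u : GSDual θ d) : WFgl hθ (A u) ⊆ WFgl hθ u := by
  intro p₀ hp₀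
  rw [mem_WFgl_iff] at hp₀ ⊢
  refine hp₀.imp_right fun hsing ⟨Γ, hopen, hΓ, hp₀Γ, ε, hε, C, hC⟩ => hsing ?_
  obtain ⟨Γ', hopen', hΓ', hp₀Γ', c, hc, hsep⟩ := hΓ.exists_isOpen_separated hopen hp₀Γ
  obtain ⟨D, hD⟩ := hgrowth.exists_norm_mul_le_exp_neg (by linarith) hε hC
  exact ⟨Γ', hopen', hΓ', hp₀Γ',
    (hgrowth.mul (hasSubexponentialGrowth_stftDual hθ u)).exists_norm_stftDual_le_of_forall_apply_eq
      hθ (fun f => (hA u f).2) hc hsep (half_pos hε) hD⟩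

end GelfandShilov

theorem mainTheorem5_general (d : ℕ) (θ : ℝ) (hθ : 1 / 2 ≤ θ)
    (a : Rd d × Rd d → ℂ) (ha : AEStronglyMeasurable a volume)
    (hbound : ∀ ε > 0, ∃ C : ℝ, ∀ᵐ p : Rd d × Rd d,
      ‖a p‖ ≤ C * Real.exp (ε * (‖p.1‖ ^ (1 / θ) + ‖p.2‖ ^ (1 / θ)))) :
    (∃! A : GSDual θ d →ₗ[ℂ] GSDual θ d, IsLocalizationOperator hθ a A) ∧
      ∀ A : GSDual θ d →ₗ[ℂ] GSDual θ d, IsLocalizationOperator hθ a A →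
        ∀ u : GSDual θ d, WFgl hθ (A u) ⊆ WFgl hθ u := by
  have hgrowth : HasSubexponentialGrowth θ a :=
    HasSubexponentialGrowth.of_norm_prod_le (by linarith) hbound
  exact ⟨existsUnique_isLocalizationOperator hθ ha hgrowth,
    fun _ hA u => WFgl_subset_of_isLocalizationOperator hθ hgrowth hA u⟩

theorem mainTheorem5 (d : ℕ) (θ : ℝ) (hθ : 1 / 2 < θ)
    (a : Rd d × Rd d → ℂ) (ha : AEStronglyMeasurable a volume)
    (hbound : ∀ ε > 0, ∃ C : ℝ, ∀ᵐ p : Rd d × Rd d,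
      ‖a p‖ ≤ C * Real.exp (ε * (‖p.1‖ ^ (1 / θ) + ‖p.2‖ ^ (1 / θ)))) :
    (∃! A : GSDual θ d →ₗ[ℂ] GSDual θ d, IsLocalizationOperator hθ.le a A) ∧
      ∀ A : GSDual θ d →ₗ[ℂ] GSDual θ d, IsLocalizationOperator hθ.le a A →
        ∀ u : GSDual θ d, WFgl hθ.le (A u) ⊆ WFgl hθ.le u :=
  mainTheorem5_general d θ hθ.le a ha hbound
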